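/- Let $p$ be a prime. Circuits act on $p$-dimensional qudits with computational basis $|x\rangle$, $x\in\mathbb{Z}/p$; a circuit is a sequence of layers of gates, the gates of a layer acting on disjoint sets of qudits; its depth is the number of layers and its size the number of gates. A circuit for inputs of $n$ qudits also has ancilla qudits initialized to $|0\rangle$. Consider nonuniform families of circuits $(C_n)_{n\ge 0}$ of depth $O(1)$ whose size and number of ancillas are bounded by a polynomial in $n$. The gates of $\mathsf{i}\text{-}\mathsf{QNC}^0_p$ are all one-qudit unitaries $U\in \mathrm{U}(p)$ and all such $U$ controlled by one qudit. The gates of $\mathsf{i}\text{-}\mathsf{QAC}^0_p$ are all $U\in\mathrm{U}(p)$ controlled by any number of qudits, together with unbounded classical fanout (a qudit is measured in the computational basis and its value is added modulo $p$ to arbitrarily many other qudits, so that qudits in state $|0\rangle$ receive copies). A controlled gate applies $U$ to its target exactly when the controls carry one prescribed basis string. The suffix $[p]$ adds the gates $\mathsf{qMOD}_p|x_0,x_1,\dots,x_k\rangle=|x_0+(x_1+\dots+x_k) \bmod p,\,x_1,\dots,x_k\rangle$ for all $k$. Then: 1. $\mathsf{i}\text{-}\mathsf{QNC}^0_p[p]=\mathsf{i}\text{-}\mathsf{QAC}^0_p[p]$: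 the two kinds of circuit families compute the same families of quantum operations (from $n$ qudits to $l(n)$ qudits, the qudits that are not output being discarded at the end). 2. The same equality holds for the families $(F_n)_n$ of operators on $n$ qudits that are implemented exactly and without measurements (hence without classical fanout) with all ancillas returned to $|0\rangle$, that is, $C_n(|\psi\rangle\otimes|0\cdots0\rangle)=F_n|\psi\rangle\otimes|0\cdots0\rangle$ for all $|\psi\rangle$. 3. The quantum OR gates on $n$ qudits, $\mathsf{qOR}|x_1,\dots,x_n\rangle=|x_1+\mathsf{OR}(x_2,\dots,x_n) \bmod p,\,x_2,\dots,x_n\rangle$, where $\mathsf{OR}$ is $0$ on the all-zero string and $1$ on every other string, are implemented by $\mathsf{i}\text{-}\mathsf{QNC}^0_p[p]$ circuit families in the sense of 2 (constant depth, polynomial size, clean ancillas). 4. The same holds for every family of multi-qudit Toffoli gates: for all choices of $U_n\in\mathrm{U}(p)$ and strings $v_n\in(\mathbb{Z}/p)^{n-1}$, the gates on $n$ qudits that apply $U_n$ to the first qudit exactly when the other $n-1$ qudits carry $v_n$. -/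

import Mathlib

namespace Qudit

/-- The computational basis of a register of `d`-dimensional qudits whose wires are labelled
by `W`: all assignments of a value in `ℤ/d` to each wire. -/
abbrev Basis (d : ℕ) (W : Type) : Type := W → ZMod d

/-- Operators (and density matrices) on the Hilbert space `(ℂ^d)^{⊗ W}`, written in the
computational basis. -/
abbrev Operator (d : ℕ) (W : Type) : Type := Matrix (Basis d W) (Basis d W) ℂ

/-- The operator `∑ x, |f x⟩⟨x|` of a map `f` between basis states. -/
noncomputable def basisMap {d : ℕ} {W : Type} (f : Basis d W → Basis d W) : Operator d W :=
  open Classical in Matrix.of fun y x => if y = f x then 1 else 0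

/-- The gates that occur in the circuit classes below, placed on the wires `W`.

* `ctrl S v t _ U`: the one-qudit unitary `U` on the target `t`, controlled by the qudits in `S`:
  it acts exactly when every control `s ∈ S` carries the basis state `|v s⟩`.
  For `S = ∅` it is the one-qudit gate `U`.
* `qmod S t _`: the gate `qMOD_d` with target `t`, which adds the sum of the qudits in `S`
  (modulo `d`) to the target.
* `cfanout c T _`: classical fanout. The wire `c` is made classical (it is measured in the
  computational basis) and its value is added to every wire in `T`. If these carry `|0⟩`,
  they receive copies of the value; for `T = ∅` it is a computational basis measurement. -/
inductive Gate (d : ℕ) [NeZero d] (W : Type) : Type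
  | ctrl (S : Finset W) (v : W → ZMod d) (t : W) (ht : t ∉ S)
      (U : Matrix.unitaryGroup (ZMod d) ℂ) : Gate d W
  | qmod (S : Finset W) (t : W) (ht : t ∉ S) : Gate d W
  | cfanout (c : W) (T : Finset W) (hc : c ∉ T) : Gate d W

section Semantics

variable {d : ℕ} [NeZero d] {W : Type} [Fintype W] [DecidableEq W]

/-- The wires on which a gate acts. -/
def Gate.support : Gate d W → Finset W
  | .ctrl S _ t _ _ => insert t S
  | .qmod S t _ => insert t S
  | .cfanout c T _ => insert c T

/-- The gate is unitary, that is, it involves no measurement. -/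
def Gate.IsUnitary : Gate d W → Prop
  | .ctrl _ _ _ _ _ => True
  | .qmod _ _ _ => True
  | .cfanout _ _ _ => False

/-- The unitary operator of a gate. (For `cfanout` this is the part that follows
the measurement.) -/
noncomputable def Gate.op : Gate d W → Operator d W
  | .ctrl S v t _ U => open Classical in Matrix.of fun y x =>
      if ∀ w, w ≠ t → y w = x w then
        if ∀ s ∈ S, x s = v s then (U : Matrix (ZMod d) (ZMod d) ℂ) (y t) (x t)
        else if y t = x t then 1 else 0
      else 0
  | .qmod S t _ => basisMap fun x => Function.update x t (x t + ∑ s ∈ S, x s)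
  | .cfanout c T _ => basisMap fun x w => if w ∈ T then x w + x c else x w

/-- The measurement of the wire `c` in the computational basis, the outcome being kept in `c`:
`ρ ↦ ∑ j, P_j ρ P_j` where `P_j` is the projection onto `|j⟩` at the wire `c`. -/
def dephase (c : W) (ρ : Operator d W) : Operator d W :=
  Matrix.of fun y x => if y c = x c then ρ y x else 0

/-- The action of a gate on density matrices. -/
noncomputable def Gate.channel : Gate d W → Operator d W → Operator d W
  | .cfanout c T h, ρ =>
      (Gate.cfanout c T h).op * dephase c ρ * (Gate.cfanout c T h).op.conjTranspose
  | g, ρ => g.op * ρ * g.op.conjTranspose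

end Semantics

/-- A circuit on the wires `W`: a sequence of layers of gates, the gates of one layer acting on
pairwise disjoint sets of wires. -/
structure Circuit (d : ℕ) [NeZero d] (W : Type) [DecidableEq W] where
  layers : List (List (Gate d W))
  disjoint : ∀ L ∈ layers, L.Pairwise fun g h => Disjoint g.support h.support

namespace Circuit

variable {d : ℕ} [NeZero d] {W : Type} [Fintype W] [DecidableEq W]

/-- The gates of a circuit in the order of application. -/
def gates (C : Circuit d W) : List (Gate d W) := C.layers.flatten

/-- The number of layers. -/
def depth (C : Circuit d W) : ℕ := C.layers.length

/-- The number of gates. -/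
def size (C : Circuit d W) : ℕ := C.gates.length

/-- The action on density matrices. -/
noncomputable def channel (C : Circuit d W) (ρ : Operator d W) : Operator d W :=
  C.gates.foldl (fun σ g => g.channel σ) ρ

/-- The action on state vectors of a circuit without measurements. -/
noncomputable def apply (C : Circuit d W) (ψ : Basis d W → ℂ) : Basis d W → ℂ :=
  C.gates.foldl (fun φ g => g.op.mulVec φ) ψ

end Circuit

section InputOutput

variable {d : ℕ} [NeZero d] {n a : ℕ}

/-- The state `ψ ⊗ |0⟩^{⊗ a}` of `n` input qudits and `a` ancilla qudits. -/
noncomputable def withAncillas (a : ℕ) (ψ : Basis d (Fin n) → ℂ) :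
    Basis d (Fin n ⊕ Fin a) → ℂ :=
  fun x => if ∀ i, x (Sum.inr i) = 0 then ψ fun i => x (Sum.inl i) else 0

/-- The density matrix `ρ ⊗ (|0⟩⟨0|)^{⊗ a}` of `n` input qudits and `a` ancilla qudits. -/
noncomputable def withAncillasDensity (a : ℕ) (ρ : Operator d (Fin n)) :
    Operator d (Fin n ⊕ Fin a) :=
  Matrix.of fun y x =>
    if (∀ i, y (Sum.inr i) = 0) ∧ (∀ i, x (Sum.inr i) = 0) then
      ρ (fun i => y (Sum.inl i)) (fun i => x (Sum.inl i))
    else 0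

/-- The partial trace that keeps the wires `out 0, …, out (l - 1)` and discards the others. -/
noncomputable def readOut {W : Type} [Fintype W] [DecidableEq W] {l : ℕ} (out : Fin l ↪ W)
    (σ : Operator d W) : Operator d (Fin l) :=
  open Classical in Matrix.of fun y x =>
    ∑ Y : Basis d W, ∑ X : Basis d W,
      if (∀ i, Y (out i) = y i) ∧ (∀ i, X (out i) = x i) ∧
          (∀ w, w ∉ Set.range out → Y w = X w) then σ Y X else 0

end InputOutput

/-- A set of admissible gates, for every register. -/
abbrev GateSet (d : ℕ) [NeZero d] : Type 1 := (W : Type) → Set (Gate d W)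

/-- The gates of `i-QNC_d`: all one-qudit unitaries, and all one-qudit unitaries controlled by
a single qudit. -/
def iQNCGates (d : ℕ) [NeZero d] : GateSet d := fun _ =>
  {g | match g with
    | .ctrl S _ _ _ _ => S.card ≤ 1
    | .qmod _ _ _ => False
    | .cfanout _ _ _ => False}

/-- The gates of `i-QAC_d`: all one-qudit unitaries, all one-qudit unitaries controlled by
arbitrarily many qudits, and unbounded classical fanout. -/
def iQACGates (d : ℕ) [NeZero d] : GateSet d := fun _ =>
  {g | match g with
    | .ctrl _ _ _ _ _ => True
    | .qmod _ _ _ => False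
    | .cfanout _ _ _ => True}

/-- The extension `[d]` of a gate set by the gates `qMOD_d` of unbounded fan-in. -/
def GateSet.withMod {d : ℕ} [NeZero d] (G : GateSet d) : GateSet d := fun W =>
  G W ∪ {g | ∃ S t ht, g = Gate.qmod S t ht}

/-- A family of quantum operations: the `n`-th one takes `n` qudits to `outputs n` qudits. -/
structure OperationFamily (d : ℕ) where
  outputs : ℕ → ℕ
  map : ∀ n, Operator d (Fin n) → Operator d (Fin (outputs n))

/-- A family of operators: the `n`-th one acts on `n` qudits. -/
abbrev OperatorFamily (d : ℕ) : Type := ∀ n, Operator d (Fin n)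

/-- The constant depth class of a gate set: the families of quantum operations that are computed
by (nonuniform) circuits of constant depth and of polynomial size over the gate set. The circuit
for `n` input qudits may use `a` ancillas initialized to `|0⟩` (polynomially many), and the qudits
that are not output are discarded at the end. -/
def ConstDepth {d : ℕ} [NeZero d] (G : GateSet d) : Set (OperationFamily d) :=
  {F | ∃ depthBound c : ℕ, ∀ n : ℕ, ∃ (a : ℕ) (C : Circuit d (Fin n ⊕ Fin a))
      (out : Fin (F.outputs n) ↪ Fin n ⊕ Fin a),
    C.depth ≤ depthBound ∧ C.size ≤ n ^ c + c ∧ a ≤ n ^ c + c ∧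
    (∀ g ∈ C.gates, g ∈ G _) ∧
    ∀ ρ, readOut out (C.channel (withAncillasDensity a ρ)) = F.map n ρ}

/-- The families of operators that are implemented exactly, with all ancillas returned to `|0⟩`,
by circuits of constant depth and of polynomial size over the gate set, without measurements. -/
def ConstDepthUnitary {d : ℕ} [NeZero d] (G : GateSet d) : Set (OperatorFamily d) :=
  {F | ∃ depthBound c : ℕ, ∀ n : ℕ, ∃ (a : ℕ) (C : Circuit d (Fin n ⊕ Fin a)),
    C.depth ≤ depthBound ∧ C.size ≤ n ^ c + c ∧ a ≤ n ^ c + c ∧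
    (∀ g ∈ C.gates, g ∈ G _ ∧ g.IsUnitary) ∧
    ∀ ψ, C.apply (withAncillas a ψ) = withAncillas a ((F n).mulVec ψ)}

/-- The gate `qOR` on `n` qudits: `|x₁, x₂, …, x_n⟩ ↦ |x₁ + OR(x₂, …, x_n), x₂, …, x_n⟩`, where
`OR` is `1` if the sum of the entries, as natural numbers below `d`, is positive and `0` otherwise.
-/
noncomputable def qOR (d : ℕ) [NeZero d] : OperatorFamily d
  | 0 => 1
  | n + 1 => basisMap fun x : Basis d (Fin (n + 1)) =>
      Function.update x 0 (x 0 + if 0 < ∑ i : Fin n, (x i.succ).val then 1 else 0)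

/-- The multi-qudit Toffoli gate on `n` qudits with the one-qudit unitary `U n`: it applies `U n`
to the first qudit exactly when the remaining qudits carry the string given by `v n`. -/
noncomputable def toffoli {d : ℕ} [NeZero d] (v : ∀ n, Fin n → ZMod d)
    (U : ℕ → Matrix.unitaryGroup (ZMod d) ℂ) : OperatorFamily d
  | 0 => 1
  | n + 1 =>
      (Gate.ctrl (Finset.univ.erase 0) (v (n + 1)) 0 (Finset.notMem_erase 0 _) (U (n + 1))).op

end Qudit

set_option linter.unusedSectionVars false

namespace Qudit

/-! ### Gates acting on state vectors, and products of gates -/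

section Semantics

variable {d : ℕ} {W : Type}

/-! Everything reduces to simulating one layer of `i-QAC[p]` gates by a number of `i-QNC[p]` layers
that depends only on `p`, with polynomially many clean ancillas (`implementable_layer`). The other
inclusion is trivial. The families `qOR` and `toffoli` are single gates or pairs of gates over
`i-QAC`, so their membership follows from the equality of the unitary classes.

The first tool is fanout. Conjugating `qMOD` by Fourier transforms exchanges source and targets, so
a wire can be copied to many others in constant depth (`copyFrame_conj_gather`). With private copies
for every pair of wires, any product of two-wire diagonal gates takes constant depth
(`Implementable.pairDiagonal`). Hence so does a `stage`, in which many wires turn the phases of many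
Fourier-transformed targets.

The second tool is an exact OR. Let `k < p ^ m` be the number of violated controls of a gate. Rotate
fresh qudits by the angles `k / p ^ (j + 1)` for `j < m`. If `k = 0` they all stay `0`. If `k = p ^
j * u` with `p ∤ u`, then qudit `j` undergoes an exact shift by `u` and is certainly nonzero. So the
string `z` of the rotated qudits, though in superposition, is zero exactly when `k = 0`
(`fourierConj_phase_ne_zero`). Next compute all `p ^ m` linear forms at `z`. A nonzero `z` makes the
same number of them nonzero, whatever `z` is (`card_dot_ne_zero`). Normalizing by this number turns
them into a total rotation by exactly `0` or `1 / p`, that is, a shift by `0` or `1`. As `m` is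
logarithmic in the number of wires, `p ^ m` is polynomial.

The auxiliary wires are now entangled with the input, but their amplitudes depend only on wires that
no gate of the layer modifies apart from those computed in place by `qMOD`. Each gate can therefore
act by consulting answer wires (`localize_layer_mulVec`), and reversing the loading returns the
ancillas to `|0⟩`.

For quantum operations, measurements are first deferred: each gate receives a fresh label wire, and
classical fanout becomes a unitary fanout that also writes to this wire, which is discarded at the
end (`deferred_measurement`). -/

theorem basisMap_mul [NeZero d] [Fintype W] [DecidableEq W] (f g : Basis d W → Basis d W) :
    basisMap f * basisMap g = basisMap (f ∘ g) := by
  ext y x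
  rw [Matrix.mul_apply, Finset.sum_eq_single (g x)]
  · simp [basisMap]
  · intro z _ hz
    simp [basisMap, hz]
  · simp

theorem basisMap_id [NeZero d] [Fintype W] [DecidableEq W] :
    basisMap (id : Basis d W → Basis d W) = 1 := by
  ext y x
  simp [basisMap, Matrix.one_apply]

theorem basisMap_mulVec [NeZero d] [Fintype W] [DecidableEq W] {f g : Basis d W → Basis d W}
    (h₁ : Function.LeftInverse f g) (h₂ : Function.LeftInverse g f) (ψ : Basis d W → ℂ) :
    (basisMap f).mulVec ψ = ψ ∘ g := by
  ext y
  rw [Matrix.mulVec, dotProduct, Finset.sum_eq_single (g y)]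
  · simp [basisMap, h₁ y]
  · intro z _ hz
    have : y ≠ f z := fun h => hz (by rw [h, h₂])
    simp [basisMap, this]
  · simp

variable [NeZero d] [Fintype W] [DecidableEq W]

theorem ctrl_mulVec (S : Finset W) (v : W → ZMod d) (t : W) (ht : t ∉ S)
    (U : Matrix.unitaryGroup (ZMod d) ℂ) (ψ : Basis d W → ℂ) (y : Basis d W) :
    (Gate.ctrl S v t ht U).op.mulVec ψ y =
      open Classical in if ∀ s ∈ S, y s = v s then
        ∑ u, (U : Matrix (ZMod d) (ZMod d) ℂ) (y t) u * ψ (Function.update y t u)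
      else ψ y := by
  classical
  have key : ∀ (g : Basis d W → ℂ), (∀ x, (¬ ∀ w, w ≠ t → y w = x w) → g x = 0) →
      ∑ x, g x = ∑ u, g (Function.update y t u) := by
    intro g hg
    rw [← Finset.sum_image (s := Finset.univ) (g := fun u => Function.update y t u)
      (fun a _ b _ h => Function.update_injective y t h)]
    refine (Finset.sum_subset (Finset.subset_univ _) fun x _ hx => hg x fun h => hx ?_).symm
    refine Finset.mem_image.2 ⟨x t, Finset.mem_univ _, ?_⟩
    ext w
    by_cases hw : w = t
    · subst hw; simp
    · simp [hw, h w hw]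
  rw [Matrix.mulVec, dotProduct, key]
  · have h1 : ∀ u, ∀ w, w ≠ t → y w = Function.update y t u w := fun u w hw => by simp [hw]
    have h2 : ∀ u, (∀ s ∈ S, Function.update y t u s = v s) ↔ ∀ s ∈ S, y s = v s := fun u =>
      forall₂_congr fun s hs => by
        rw [Function.update_of_ne (ne_of_mem_of_not_mem hs ht)]
    simp only [Gate.op, Matrix.of_apply, if_pos (h1 _), h2]
    split_ifs with h
    · simp
    · rw [Finset.sum_eq_single (y t)]
      · simp
      · intro u _ hu
        simp [Ne.symm hu]
      · simp
  · intro x hx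
    simp only [Gate.op, Matrix.of_apply, if_neg hx, zero_mul]

theorem qmod_mulVec (S : Finset W) (t : W) (ht : t ∉ S) (ψ : Basis d W → ℂ) :
    (Gate.qmod S t ht).op.mulVec ψ =
      fun y => ψ (Function.update y t (y t - ∑ s ∈ S, y s)) := by
  have h : ∀ (x : Basis d W) (a : ZMod d),
      ∑ s ∈ S, Function.update x t a s = ∑ s ∈ S, x s := fun x a =>
    Finset.sum_congr rfl fun s hs => Function.update_of_ne (ne_of_mem_of_not_mem hs ht) _ _
  refine basisMap_mulVec ?_ ?_ ψ <;> intro x <;> simp [h]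

theorem cfanout_mulVec (c : W) (T : Finset W) (hc : c ∉ T) (ψ : Basis d W → ℂ) :
    (Gate.cfanout c T hc).op.mulVec ψ = fun y => ψ fun w => if w ∈ T then y w - y c else y w := by
  refine basisMap_mulVec ?_ ?_ ψ <;> intro x <;> ext w <;> by_cases hw : w ∈ T <;> simp [hw, hc]

/-- The operator of a sequence of gates, measurements being skipped. -/
noncomputable def ops : List (Gate d W) → Operator d W
  | [] => 1
  | g :: gs => ops gs * g.op

@[simp] theorem ops_nil : ops ([] : List (Gate d W)) = 1 := rfl

@[simp] theorem ops_cons (g : Gate d W) (gs : List (Gate d W)) :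
    ops (g :: gs) = ops gs * g.op := rfl

@[simp] theorem ops_append (gs hs : List (Gate d W)) : ops (gs ++ hs) = ops hs * ops gs := by
  induction gs with
  | nil => simp
  | cons g gs ih => simp [ih, Matrix.mul_assoc]

theorem foldl_op_mulVec (gs : List (Gate d W)) (ψ : Basis d W → ℂ) :
    gs.foldl (fun φ g => g.op.mulVec φ) ψ = (ops gs).mulVec ψ := by
  induction gs generalizing ψ with
  | nil => simp
  | cons g gs ih => simp [ih, Matrix.mulVec_mulVec]

theorem Circuit.apply_eq (C : Circuit d W) (ψ : Basis d W → ℂ) :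
    C.apply ψ = (ops C.gates).mulVec ψ := foldl_op_mulVec _ _

theorem Circuit.channel_eq (C : Circuit d W) (hC : ∀ g ∈ C.gates, g.IsUnitary)
    (ρ : Operator d W) : C.channel ρ = ops C.gates * ρ * (ops C.gates).conjTranspose := by
  suffices h : ∀ gs : List (Gate d W), (∀ g ∈ gs, g.IsUnitary) → ∀ ρ : Operator d W,
      gs.foldl (fun σ g => g.channel σ) ρ = ops gs * ρ * (ops gs).conjTranspose from h _ hC ρ
  intro gs
  induction gs with
  | nil => simp
  | cons g gs ih =>
    intro h ρ
    have hg : g.channel ρ = g.op * ρ * g.op.conjTranspose := by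
      cases g with
      | ctrl => rfl
      | qmod => rfl
      | cfanout => exact (h _ (List.mem_cons_self ..)).elim
    rw [List.foldl_cons, ih (fun g hg => h g (List.mem_cons_of_mem _ hg)), hg]
    simp only [ops_cons, Matrix.conjTranspose_mul, Matrix.mul_assoc]

end Semantics

/-! ### Relabelling wires and adding wires in state `|0⟩` -/

section Relabel

variable {d : ℕ} {V W : Type}

/-- The state that is `ψ` on the wires in the range of `f` and `|0⟩` on the others. -/
noncomputable def extendZero (f : V ↪ W) (ψ : Basis d V → ℂ) : Basis d W → ℂ :=
  open Classical in fun y => if ∀ w, w ∉ Set.range f → y w = 0 then ψ (y ∘ f) else 0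

theorem extend_comp_self (f : V ↪ W) (y : Basis d W) : Function.extend f (y ∘ f) y = y := by
  ext w
  by_cases hw : ∃ v, f v = w
  · obtain ⟨v, rfl⟩ := hw
    simp [f.injective.extend_apply]
  · rw [Function.extend_apply' _ _ _ hw]

variable [NeZero d]

/-- A gate with its wires relabelled. -/
noncomputable def Gate.map (f : V ↪ W) : Gate d V → Gate d W
  | .ctrl S v t ht U => .ctrl (S.map f) (Function.extend f v 0) (f t) (by simpa using ht) U
  | .qmod S t ht => .qmod (S.map f) (f t) (by simpa using ht)
  | .cfanout c T hc => .cfanout (f c) (T.map f) (by simpa using hc)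

variable [DecidableEq V] [DecidableEq W]

theorem Gate.support_map (f : V ↪ W) (g : Gate d V) :
    (g.map f).support = g.support.map f := by
  cases g <;> simp [Gate.map, Gate.support, Finset.map_insert]

theorem extend_update (f : V ↪ W) (x : Basis d V) (y : Basis d W) (t : V) (u : ZMod d) :
    Function.extend f (Function.update x t u) y =
      Function.update (Function.extend f x y) (f t) u := by
  ext w
  by_cases hw : ∃ v, f v = w
  · obtain ⟨v, rfl⟩ := hw
    rw [f.injective.extend_apply]
    by_cases h : v = t
    · subst h; simp
    · simp [h, f.injective.extend_apply]
  · rw [Function.extend_apply' _ _ _ hw, Function.update_of_ne (fun h => hw ⟨t, h.symm⟩),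
      Function.extend_apply' _ _ _ hw]

variable [Fintype V] [Fintype W]

/-- Wires outside the range of `f` are untouched by the relabelled gate, so they enter only as
parameters frozen at `z`. -/
theorem Gate.map_mulVec (f : V ↪ W) (g : Gate d V) (φ : Basis d W → ℂ) (y z : Basis d W)
    (hz : ∀ w, w ∉ Set.range f → y w = z w) :
    (g.map f).op.mulVec φ y =
      g.op.mulVec (fun x => φ (Function.extend f x z)) (y ∘ f) := by
  have hy : ∀ x : Basis d V, Function.extend f x z = Function.extend f x y := by
    intro x; ext w
    by_cases hw : ∃ v, f v = w
    · obtain ⟨v, rfl⟩ := hw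
      simp [f.injective.extend_apply]
    · rw [Function.extend_apply' _ _ _ hw, Function.extend_apply' _ _ _ hw, hz w hw]
  simp only [hy]
  cases g with
  | ctrl S v t ht U =>
    rw [Gate.map, ctrl_mulVec, ctrl_mulVec]
    simp [extend_update, extend_comp_self, f.injective.extend_apply]
  | qmod S t ht =>
    simp [Gate.map, qmod_mulVec, extend_update, extend_comp_self]
  | cfanout c T hc =>
    simp only [Gate.map, cfanout_mulVec]
    congr 1
    ext w
    by_cases hw : ∃ v, f v = w
    · obtain ⟨v, rfl⟩ := hw
      simp [f.injective.extend_apply]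
    · rw [Function.extend_apply' _ _ _ hw, if_neg]
      intro h
      obtain ⟨v, -, hv⟩ := Finset.mem_map.1 h
      exact hw ⟨v, hv⟩

theorem ops_map_mulVec (f : V ↪ W) (gs : List (Gate d V)) (ψ : Basis d V → ℂ) :
    (ops (gs.map (Gate.map f))).mulVec (extendZero f ψ) =
      extendZero f ((ops gs).mulVec ψ) := by
  induction gs generalizing ψ with
  | nil => simp
  | cons g gs ih =>
    have : (g.map f).op.mulVec (extendZero f ψ) = extendZero f (g.op.mulVec ψ) := by
      ext y
      rw [Gate.map_mulVec f g _ y y fun _ _ => rfl]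
      by_cases hy : ∀ w, w ∉ Set.range f → y w = 0
      · have : (fun x => extendZero f ψ (Function.extend f x y)) = ψ := by
          ext x
          have h : ∀ w, w ∉ Set.range f → Function.extend f x y w = 0 := fun w hw => by
            rw [Function.extend_apply' _ _ _ hw, hy w hw]
          rw [extendZero, if_pos h]
          congr 1
          ext v
          simp [f.injective.extend_apply]
        rw [this, extendZero, if_pos hy]
      · have : (fun x => extendZero f ψ (Function.extend f x y)) = 0 := by
          ext x
          rw [extendZero, if_neg]; · rfl
          intro h
          refine hy fun w hw => ?_
          rw [← h w hw, Function.extend_apply' _ _ _ hw]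
        rw [this, extendZero, if_neg hy, Matrix.mulVec_zero]
        rfl
    rw [List.map_cons, ops_cons, ← Matrix.mulVec_mulVec, this, ih, ops_cons,
      Matrix.mulVec_mulVec]

theorem extendZero_trans {X : Type} (f : V ↪ W) (g : W ↪ X) (ψ : Basis d V → ℂ) :
    extendZero g (extendZero f ψ) = extendZero (f.trans g) ψ := by
  ext y
  simp only [extendZero]
  have : (∀ x, x ∉ Set.range (f.trans g) → y x = 0) ↔
      (∀ x, x ∉ Set.range g → y x = 0) ∧ ∀ w, w ∉ Set.range f → (y ∘ g) w = 0 := by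
    constructor
    · intro h
      refine ⟨fun x hx => h x ?_, fun w hw => h _ ?_⟩
      · rintro ⟨v, rfl⟩
        exact hx ⟨f v, rfl⟩
      · rintro ⟨v, hv⟩
        exact hw ⟨v, g.injective hv⟩
    · rintro ⟨h1, h2⟩ x hx
      by_cases hg : x ∈ Set.range g
      · obtain ⟨w, rfl⟩ := hg
        refine h2 w ?_
        rintro ⟨v, rfl⟩
        exact hx ⟨v, rfl⟩
      · exact h1 x hg
  by_cases h1 : ∀ x, x ∉ Set.range g → y x = 0
  · by_cases h2 : ∀ w, w ∉ Set.range f → (y ∘ g) w = 0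
    · rw [if_pos h1, if_pos h2, if_pos (this.2 ⟨h1, h2⟩)]; rfl
    · rw [if_pos h1, if_neg h2, if_neg fun h => h2 (this.1 h).2]
  · rw [if_neg h1, if_neg fun h => h1 (this.1 h).1]

theorem withAncillas_eq {n a : ℕ} (ψ : Basis d (Fin n) → ℂ) :
    withAncillas a ψ = extendZero Function.Embedding.inl ψ := by
  ext y
  simp [withAncillas, extendZero, Function.comp_def]

end Relabel

/-! ### Size from depth and number of wires -/

section Layers

variable {d : ℕ} [NeZero d] {W : Type} [Fintype W] [DecidableEq W]

theorem Gate.support_nonempty (g : Gate d W) : g.support.Nonempty := by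
  cases g <;> exact Finset.insert_nonempty _ _

theorem length_le_card_of_pairwise {L : List (Gate d W)}
    (hL : L.Pairwise fun g h => Disjoint g.support h.support) : L.length ≤ Fintype.card W := by
  suffices h : ∃ s : Finset W, L.length ≤ s.card ∧ ∀ g ∈ L, g.support ⊆ s ∧
      ∀ w ∈ s, ∃ g ∈ L, w ∈ g.support by
    obtain ⟨s, hs, -⟩ := h
    exact hs.trans (Finset.card_le_univ s)
  refine ⟨Finset.univ.filter fun w => ∃ g ∈ L, w ∈ g.support, ?_, fun g hg =>
    ⟨fun w hw => by simpa using ⟨g, hg, hw⟩, fun w hw => by simpa using hw⟩⟩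
  induction L with
  | nil => simp
  | cons g L ih =>
    rw [List.pairwise_cons] at hL
    have hd : Disjoint g.support (Finset.univ.filter fun w => ∃ g ∈ L, w ∈ g.support) := by
      rw [Finset.disjoint_left]
      intro w hw hw'
      obtain ⟨h, hh, hwh⟩ := (Finset.mem_filter.1 hw').2
      exact Finset.disjoint_left.1 (hL.1 h hh) hw hwh
    have he : (Finset.univ.filter fun w => ∃ g' ∈ g :: L, w ∈ g'.support) =
        g.support ∪ Finset.univ.filter fun w => ∃ g ∈ L, w ∈ g.support := by
      ext w; simp
    rw [he, Finset.card_union_of_disjoint hd, List.length_cons]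
    have := ih hL.2
    have := g.support_nonempty.card_pos
    omega

/-- Gates of one layer have disjoint nonempty supports. Because of this bound the simulation needs
to control only depth and number of wires. -/
theorem Circuit.size_le (C : Circuit d W) : C.size ≤ C.depth * Fintype.card W := by
  have h : ∀ Ls : List (List (Gate d W)),
      (∀ L ∈ Ls, L.Pairwise fun g h => Disjoint g.support h.support) →
      Ls.flatten.length ≤ Ls.length * Fintype.card W := by
    intro Ls
    induction Ls with
    | nil => simp
    | cons L Ls ih =>
      intro h
      have h1 := length_le_card_of_pairwise (h L (List.mem_cons_self ..))
      have h2 := ih fun L hL => h L (List.mem_cons_of_mem _ hL)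
      rw [List.flatten_cons, List.length_append, List.length_cons, add_mul]
      omega
  exact h _ C.disjoint

end Layers

end Qudit

namespace Qudit

/-! ### Layers of one-qudit gates and parallel `qMOD` gates -/

section Tensor

variable {d : ℕ} [NeZero d] {V : Type} [Fintype V] [DecidableEq V]

/-- The tensor product of one-qudit operators. -/
def tens (U : V → Matrix (ZMod d) (ZMod d) ℂ) : Operator d V :=
  Matrix.of fun y x => ∏ w, U w (y w) (x w)

theorem tens_mul (U U' : V → Matrix (ZMod d) (ZMod d) ℂ) :
    tens U * tens U' = tens fun w => U w * U' w := by
  ext y x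
  simp only [Matrix.mul_apply, tens, Matrix.of_apply, Finset.prod_univ_sum, Fintype.piFinset_univ,
    Finset.prod_mul_distrib]

theorem sum_basis_prod (f : V → ZMod d → ℂ) :
    ∑ z : Basis d V, ∏ w, f w (z w) = ∏ w, ∑ b, f w b := by
  rw [Finset.prod_univ_sum, Fintype.piFinset_univ]

theorem tens_one : tens (fun _ : V => (1 : Matrix (ZMod d) (ZMod d) ℂ)) = 1 := by
  ext y x
  simp only [tens, Matrix.of_apply, Matrix.one_apply]
  by_cases h : y = x
  · simp [h]
  · rw [if_neg h]
    obtain ⟨w, hw⟩ := Function.ne_iff.1 h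
    exact Finset.prod_eq_zero (Finset.mem_univ w) (if_neg hw)

/-- One-qudit gates on all wires. -/
noncomputable def tensLayer (U : V → Matrix.unitaryGroup (ZMod d) ℂ) : List (Gate d V) :=
  (Finset.univ : Finset V).toList.map fun w => Gate.ctrl ∅ 0 w (Finset.notMem_empty w) (U w)

theorem ops_tensLayer (U : V → Matrix.unitaryGroup (ZMod d) ℂ) :
    ops (tensLayer U) = tens fun w => (U w : Matrix (ZMod d) (ZMod d) ℂ) := by
  suffices h : ∀ l : List V, l.Nodup →
      ops (l.map fun w => Gate.ctrl ∅ 0 w (Finset.notMem_empty w) (U w)) =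
        tens fun w => if w ∈ l then (U w : Matrix (ZMod d) (ZMod d) ℂ) else 1 by
    rw [tensLayer, h _ (Finset.nodup_toList _)]
    simp
  intro l
  induction l with
  | nil => intro; simpa using tens_one.symm
  | cons v l ih =>
    intro h
    rw [List.nodup_cons] at h
    have hv : (Gate.ctrl ∅ 0 v (Finset.notMem_empty v) (U v)).op =
        tens fun w => if w = v then (U v : Matrix (ZMod d) (ZMod d) ℂ) else 1 := by
      ext y x
      simp only [Gate.op, tens, Matrix.of_apply]
      rw [← Finset.mul_prod_erase _ _ (Finset.mem_univ v)]
      have he : (∏ w ∈ Finset.univ.erase v,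
          (if w = v then (U v : Matrix (ZMod d) (ZMod d) ℂ) else 1) (y w) (x w)) =
          ∏ w ∈ Finset.univ.erase v, if y w = x w then 1 else 0 := by
        refine Finset.prod_congr rfl fun w hw => ?_
        rw [if_neg (Finset.ne_of_mem_erase hw), Matrix.one_apply]
      rw [he, Finset.prod_ite_zero]
      simp
    rw [List.map_cons, ops_cons, ih h.2, hv, tens_mul]
    congr 1
    ext1 w
    by_cases hw : w = v
    · subst hw; simp [h.1]
    · simp [hw]

/-- Gates `qMOD` with targets `l`, none of which is a summand of another one. -/
theorem ops_qmod_list (l : List V) (hl : l.Nodup) (S : V → Finset V) (hS : ∀ i, i ∉ S i)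
    (h : ∀ i ∈ l, ∀ j ∈ l, i ∉ S j) :
    ops (l.map fun i => Gate.qmod (d := d) (S i) i (hS i)) =
      basisMap fun x w => if w ∈ l then x w + ∑ s ∈ S w, x s else x w := by
  induction l with
  | nil =>
    simp only [List.map_nil, ops_nil, List.not_mem_nil, if_false]
    exact basisMap_id.symm
  | cons v l ih =>
    rw [List.nodup_cons] at hl
    rw [List.map_cons, ops_cons, ih hl.2 fun i hi j hj =>
      h i (List.mem_cons_of_mem _ hi) j (List.mem_cons_of_mem _ hj), Gate.op, basisMap_mul]
    congr 1
    ext x w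
    -- No target is a summand of another gate, so changing the first target leaves all the sums as
    -- they were.
    have hs : ∀ w ∈ v :: l, ∀ a, ∑ s ∈ S w, Function.update x v a s = ∑ s ∈ S w, x s :=
      fun w hw a => Finset.sum_congr rfl fun s hs => Function.update_of_ne
        (ne_of_mem_of_not_mem hs (h v (List.mem_cons_self ..) w hw)) _ _
    by_cases hw : w = v
    · subst hw; simp [hl.1]
    · by_cases hwl : w ∈ l
      · simp [hwl, hw, hs w (List.mem_cons_of_mem _ hwl)]
      · simp [hwl, hw]

end Tensor

/-! ### Characters and Fourier transforms of `ℤ/d` -/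

section Fourier

variable {d : ℕ} [NeZero d]

/-- The Fourier transform of `ℤ/d` for the character with frequency `ε`. -/
noncomputable def fourierMatrix (ε : ZMod d) : Matrix (ZMod d) (ZMod d) ℂ :=
  Matrix.of fun y x => ((√d)⁻¹ : ℂ) * ZMod.stdAddChar (ε * y * x)

theorem sqrt_inv_mul_self : ((√(d : ℝ) : ℝ) : ℂ)⁻¹ * ((√(d : ℝ) : ℝ) : ℂ)⁻¹ = (d : ℂ)⁻¹ := by
  rw [← mul_inv, ← Complex.ofReal_mul, Real.mul_self_sqrt (Nat.cast_nonneg d)]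
  simp

theorem stdAddChar_sum {ι : Type} (s : Finset ι) (f : ι → ZMod d) :
    (ZMod.stdAddChar (∑ i ∈ s, f i) : ℂ) = ∏ i ∈ s, ZMod.stdAddChar (f i) := by
  classical
  induction s using Finset.induction_on with
  | empty => simp
  | insert i s hi ih =>
    rw [Finset.sum_insert hi, Finset.prod_insert hi, AddChar.map_add_eq_mul, ih]

theorem star_fourierMatrix_apply (ε y x : ZMod d) :
    star (fourierMatrix ε) y x = ((√d)⁻¹ : ℂ) * ZMod.stdAddChar (-(ε * x * y)) := by
  rw [Matrix.star_apply, fourierMatrix, Matrix.of_apply, star_mul', AddChar.map_neg_eq_conj]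
  simp

theorem sum_stdAddChar_mul (c : ZMod d) :
    ∑ b : ZMod d, (ZMod.stdAddChar (b * c) : ℂ) = if c = 0 then (d : ℂ) else 0 := by
  rw [AddChar.sum_mulShift c (ZMod.isPrimitive_stdAddChar d), ZMod.card]
  split_ifs <;> simp

theorem inv_mul_sum_stdAddChar_mul (c : ZMod d) :
    ∑ b : ZMod d, (d : ℂ)⁻¹ * (ZMod.stdAddChar (b * c) : ℂ) = if c = 0 then 1 else 0 := by
  rw [← Finset.mul_sum, sum_stdAddChar_mul]
  split_ifs
  · exact inv_mul_cancel₀ (Nat.cast_ne_zero.2 (NeZero.ne d))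
  · simp

/-- Orthogonality of characters; since `ε` is a unit, `ε * (y - x) = 0` forces `y = x`. -/
theorem fourierMatrix_mem (ε : (ZMod d)ˣ) :
    fourierMatrix (ε : ZMod d) ∈ Matrix.unitaryGroup (ZMod d) ℂ := by
  rw [Matrix.mem_unitaryGroup_iff]
  ext y x
  have h : ∀ b, fourierMatrix (ε : ZMod d) y b * star (fourierMatrix (ε : ZMod d)) b x =
      (d : ℂ)⁻¹ * ZMod.stdAddChar (b * ((ε : ZMod d) * (y - x))) := fun b => by
    rw [star_fourierMatrix_apply, fourierMatrix, Matrix.of_apply, mul_mul_mul_comm,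
      ← AddChar.map_add_eq_mul, sqrt_inv_mul_self]
    congr 2
    ring
  simp only [Matrix.mul_apply, h, inv_mul_sum_stdAddChar_mul, Matrix.one_apply,
    Units.mul_right_eq_zero, sub_eq_zero]

/-- The Fourier transform as a one-qudit gate. -/
noncomputable def fourier (ε : (ZMod d)ˣ) : Matrix.unitaryGroup (ZMod d) ℂ :=
  ⟨fourierMatrix (ε : ZMod d), fourierMatrix_mem ε⟩

end Fourier

/-! ### Implementation with clean ancillas -/

section Implementable

variable {d : ℕ} [NeZero d] {U V X : Type} [Fintype U] [DecidableEq U] [Fintype V] [DecidableEq V]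
  [Fintype X] [DecidableEq X]

/-- The operator `M` on the wires `V` is implemented, with clean ancillas, in depth `D` by the
gates of `i-QNC_d[d]` on the wires `X`, among which those of `V` are found through `ι`. -/
def Implementable (ι : V ↪ X) (D : ℕ) (M : Operator d V) : Prop :=
  ∃ Ls : List (List (Gate d X)), Ls.length ≤ D ∧
    (∀ L ∈ Ls, L.Pairwise fun g h => Disjoint g.support h.support) ∧
    (∀ L ∈ Ls, ∀ g ∈ L, g ∈ (iQNCGates d).withMod X) ∧
    ∀ ψ, (ops Ls.flatten).mulVec (extendZero ι ψ) = extendZero ι (M.mulVec ψ)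

theorem Implementable.mul {ι : V ↪ X} {D D' : ℕ} {M N : Operator d V}
    (hM : Implementable ι D M) (hN : Implementable ι D' N) : Implementable ι (D' + D) (M * N) := by
  obtain ⟨Ls, h1, h2, h3, h4⟩ := hM
  obtain ⟨Ls', h1', h2', h3', h4'⟩ := hN
  refine ⟨Ls' ++ Ls, by simpa using Nat.add_le_add h1' h1, ?_, ?_, fun ψ => ?_⟩
  · intro L hL
    rcases List.mem_append.1 hL with hL | hL
    exacts [h2' L hL, h2 L hL]
  · intro L hL
    rcases List.mem_append.1 hL with hL | hL
    exacts [h3' L hL, h3 L hL]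
  · rw [List.flatten_append, ops_append, ← Matrix.mulVec_mulVec, h4', h4, Matrix.mulVec_mulVec]

theorem Implementable.one (ι : V ↪ X) : Implementable ι 0 (1 : Operator d V) :=
  ⟨[], by simp⟩

theorem Gate.map_mem {g : Gate d V} (f : V ↪ X) (hg : g ∈ (iQNCGates d).withMod V) :
    g.map f ∈ (iQNCGates d).withMod X := by
  rcases hg with hg | ⟨S, t, ht, rfl⟩
  · cases g with
    | ctrl S v t ht U =>
      left
      change (S.map f).card ≤ 1
      rw [Finset.card_map]
      exact hg
    | qmod => exact hg.elim
    | cfanout => exact hg.elim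
  · exact Or.inr ⟨_, _, _, rfl⟩

theorem pairwise_map_gate {L : List (Gate d V)} (f : V ↪ X)
    (hL : L.Pairwise fun g h => Disjoint g.support h.support) :
    (L.map (Gate.map f)).Pairwise fun g h => Disjoint g.support h.support := by
  refine List.pairwise_map.2 (hL.imp fun h => ?_)
  rwa [Gate.support_map, Gate.support_map, Finset.disjoint_map]

theorem Implementable.layer (ι : V ↪ X) {L : List (Gate d V)}
    (hL : L.Pairwise fun g h => Disjoint g.support h.support)
    (hg : ∀ g ∈ L, g ∈ (iQNCGates d).withMod V) : Implementable ι 1 (ops L) := by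
  refine ⟨[L.map (Gate.map ι)], le_rfl, ?_, ?_, fun ψ => ?_⟩
  · simpa using pairwise_map_gate ι hL
  · intro L' hL' g hg'
    rw [List.mem_singleton.1 hL'] at hg'
    obtain ⟨g, h, rfl⟩ := List.mem_map.1 hg'
    exact Gate.map_mem ι (hg g h)
  · rw [List.flatten_singleton, ops_map_mulVec]

/-- This turns auxiliary wires into clean ancillas: `M` may be anything on `V`, provided that it
acts as `N` and restores the zeros when the wires outside `U` start at `|0⟩`. -/
theorem Implementable.restrict {ι : V ↪ X} {κ : U ↪ V} {D : ℕ} {M : Operator d V}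
    {N : Operator d U} (hM : Implementable ι D M)
    (h : ∀ ψ, M.mulVec (extendZero κ ψ) = extendZero κ (N.mulVec ψ)) :
    Implementable (κ.trans ι) D N := by
  obtain ⟨Ls, h1, h2, h3, h4⟩ := hM
  refine ⟨Ls, h1, h2, h3, fun ψ => ?_⟩
  rw [← extendZero_trans, ← extendZero_trans, h4, h]

theorem tensLayer_pairwise (G : V → Matrix.unitaryGroup (ZMod d) ℂ) :
    (tensLayer G).Pairwise fun g h => Disjoint g.support h.support := by
  refine List.pairwise_map.2 ((Finset.nodup_toList _).imp fun h => ?_)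
  simpa [Gate.support] using h

theorem tensLayer_mem (G : V → Matrix.unitaryGroup (ZMod d) ℂ) :
    ∀ g ∈ tensLayer G, g ∈ (iQNCGates d).withMod V := by
  intro g hg
  obtain ⟨w, -, rfl⟩ := List.mem_map.1 hg
  left
  simp [iQNCGates]

theorem Implementable.tens (ι : V ↪ X) (G : V → Matrix.unitaryGroup (ZMod d) ℂ) :
    Implementable ι 1 (Qudit.tens fun w => (G w : Matrix (ZMod d) (ZMod d) ℂ)) := by
  rw [← ops_tensLayer]
  exact .layer ι (tensLayer_pairwise G) (tensLayer_mem G)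

theorem Implementable.mono {ι : V ↪ X} {D D' : ℕ} {M : Operator d V}
    (hM : Implementable ι D M) (h : D ≤ D') : Implementable ι D' M := by
  obtain ⟨Ls, h1, h2⟩ := hM
  exact ⟨Ls, h1.trans h, h2⟩

end Implementable

/-! ### Fanout from `qMOD` by Fourier conjugation -/

section Copy

variable {d : ℕ} [NeZero d] {V P : Type} [Fintype V] [DecidableEq V] [Fintype P] [DecidableEq P]

theorem extendZero_inl (ψ : Basis d V → ℂ) (y : Basis d (V ⊕ P)) :
    extendZero Function.Embedding.inl ψ y =
      open Classical in if ∀ q, y (Sum.inr q) = 0 then ψ (y ∘ Sum.inl) else 0 := by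
  simp [extendZero, Function.comp_def]

/-- The wires that copy `i`. -/
def copiesOf (owner : P → V) : V ⊕ P → Finset (V ⊕ P)
  | .inl i => (Finset.univ.filter fun q => owner q = i).map Function.Embedding.inr
  | .inr _ => ∅

theorem notMem_copiesOf (owner : P → V) (w : V ⊕ P) : w ∉ copiesOf owner w := by
  cases w <;> simp [copiesOf]

theorem inl_notMem_copiesOf (owner : P → V) (i : V) (w : V ⊕ P) :
    Sum.inl i ∉ copiesOf owner w := by
  cases w <;> simp [copiesOf]

/-- Addition of the copies to the wires that own them. -/
noncomputable def gatherLayer (owner : P → V) : List (Gate d (V ⊕ P)) :=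
  ((Finset.univ : Finset V).toList.map Sum.inl).map fun w =>
    Gate.qmod (copiesOf owner w) w (notMem_copiesOf owner w)

theorem ops_gatherLayer (owner : P → V) :
    ops (gatherLayer (d := d) owner) = basisMap fun x => Sum.elim
      (fun i => x (.inl i) + ∑ q with owner q = i, x (.inr q)) (x ∘ Sum.inr) := by
  rw [gatherLayer, ops_qmod_list]
  · congr 1
    ext x w
    cases w <;> simp [copiesOf]
  · exact (Finset.nodup_toList _).map Sum.inl_injective
  · intro i hi j _
    obtain ⟨i, -, rfl⟩ := List.mem_map.1 hi
    exact inl_notMem_copiesOf owner i j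

theorem gatherLayer_pairwise (owner : P → V) :
    (gatherLayer (d := d) owner).Pairwise fun g h => Disjoint g.support h.support := by
  rw [gatherLayer, List.map_map]
  refine List.pairwise_map.2 ((Finset.nodup_toList _).imp fun {i j} h => ?_)
  rw [Finset.disjoint_left]
  rintro (w | w)
  · simp only [Gate.support, Function.comp, Finset.mem_insert, inl_notMem_copiesOf, or_false]
    rintro h1 h2
    exact h (Sum.inl_injective (h1.symm.trans h2))
  · simp only [Gate.support, Function.comp, Finset.mem_insert, copiesOf]
    simp only [reduceCtorEq, Finset.mem_map, Finset.mem_filter, Finset.mem_univ, true_and,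
      Function.Embedding.inr_apply, Sum.inr.injEq, exists_eq_right, false_or]
    rintro h1 h2
    exact h (h1.symm.trans h2)

theorem gatherLayer_mem (owner : P → V) :
    ∀ g ∈ gatherLayer (d := d) owner, g ∈ (iQNCGates d).withMod (V ⊕ P) := by
  intro g hg
  obtain ⟨w, -, rfl⟩ := List.mem_map.1 hg
  exact Or.inr ⟨_, _, _, rfl⟩

/-- Fourier transforms on all wires, with frequency `ε` on the copies. -/
noncomputable def copyFrame (ε : (ZMod d)ˣ) : V ⊕ P → Matrix.unitaryGroup (ZMod d) ℂ :=
  Sum.elim (fun _ => fourier 1) (fun _ => fourier ε)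

/-- Each entry is a sum over an intermediate basis state `z` of a character whose exponent is linear
in `z`. The sum factors over the wires into character sums, each forcing one coefficient to vanish.
The frequency `ε` sets the sign: `-1` makes copies and `1` erases them, so no inverse of `qMOD` is
needed. -/
theorem copyFrame_conj_gather (owner : P → V) (ε : (ZMod d)ˣ) :
    tens (fun w => star (copyFrame (V := V) ε w : Matrix (ZMod d) (ZMod d) ℂ)) *
        ops (gatherLayer owner) *
        tens (fun w => (copyFrame ε w : Matrix (ZMod d) (ZMod d) ℂ)) =
      basisMap fun x => Sum.elim (x ∘ Sum.inl)
        fun q => x (.inr q) - ((ε⁻¹ : (ZMod d)ˣ) : ZMod d) * x (.inl (owner q)) := by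
  let e : V ⊕ P → ZMod d := Sum.elim (fun _ => 1) (fun _ => (ε : ZMod d))
  let A : Basis d (V ⊕ P) → Basis d (V ⊕ P) := fun x => Sum.elim
    (fun i => x (.inl i) + ∑ q with owner q = i, x (.inr q)) (x ∘ Sum.inr)
  have hF : ∀ w y x, (copyFrame (V := V) (P := P) ε w : Matrix (ZMod d) (ZMod d) ℂ) y x =
      ((√d)⁻¹ : ℂ) * ZMod.stdAddChar (e w * y * x) := by
    rintro (w | w) y x <;> simp [copyFrame, e, fourier, fourierMatrix]
  have hF' : ∀ w y x,
      star (copyFrame (V := V) (P := P) ε w : Matrix (ZMod d) (ZMod d) ℂ) y x =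
      ((√d)⁻¹ : ℂ) * ZMod.stdAddChar (-(e w * x * y)) := by
    rintro (w | w) y x
    · exact star_fourierMatrix_apply _ _ _
    · exact star_fourierMatrix_apply _ _ _
  ext y x
  -- The coefficient of `z w` in the exponent, as `hexp` verifies.
  let c : V ⊕ P → ZMod d := Sum.elim (fun i => x (.inl i) - y (.inl i))
    fun q => ε * x (.inr q) - ε * y (.inr q) - y (.inl (owner q))
  have hexp : ∀ z : Basis d (V ⊕ P),
      ∑ w, (-(e w * A z w * y w) + e w * z w * x w) = ∑ w, z w * c w := by
    intro z
    simp only [Fintype.sum_sum_type, e, A, c, Sum.elim_inl, Sum.elim_inr, Function.comp]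
    have h : ∑ i, (∑ q with owner q = i, z (.inr q)) * y (.inl i) =
        ∑ q, z (.inr q) * y (.inl (owner q)) := by
      rw [← Finset.sum_fiberwise Finset.univ owner]
      refine Finset.sum_congr rfl fun i _ => ?_
      rw [Finset.sum_mul]
      refine Finset.sum_congr rfl fun q hq => ?_
      rw [(Finset.mem_filter.1 hq).2]
    have h1 : ∑ i, (-(1 * (z (.inl i) + ∑ q with owner q = i, z (.inr q)) * y (.inl i)) +
        1 * z (.inl i) * x (.inl i)) = ∑ i, z (.inl i) * (x (.inl i) - y (.inl i)) -
        ∑ q, z (.inr q) * y (.inl (owner q)) := by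
      rw [← h, ← Finset.sum_sub_distrib]
      exact Finset.sum_congr rfl fun i _ => by ring
    rw [h1, sub_add, sub_eq_add_neg, ← Finset.sum_sub_distrib, ← Finset.sum_neg_distrib]
    congr 1
    exact Finset.sum_congr rfl fun i _ => by ring
  have hz : ∀ z : Basis d (V ⊕ P),
      tens (fun w => star (copyFrame (V := V) ε w : Matrix (ZMod d) (ZMod d) ℂ)) y (A z) *
        tens (fun w => (copyFrame ε w : Matrix (ZMod d) (ZMod d) ℂ)) z x =
      ∏ w, ((d : ℂ)⁻¹ * ZMod.stdAddChar (z w * c w)) := by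
    intro z
    have hr : ∏ w, ((d : ℂ)⁻¹ * ZMod.stdAddChar (z w * c w)) =
        ∏ w, ((d : ℂ)⁻¹ * ZMod.stdAddChar (-(e w * A z w * y w) + e w * z w * x w)) := by
      rw [Finset.prod_mul_distrib, ← stdAddChar_sum, ← hexp, stdAddChar_sum,
        ← Finset.prod_mul_distrib]
    rw [hr, tens, tens, Matrix.of_apply, Matrix.of_apply, ← Finset.prod_mul_distrib]
    refine Finset.prod_congr rfl fun w _ => ?_
    rw [hF, hF', mul_mul_mul_comm, sqrt_inv_mul_self, AddChar.map_add_eq_mul]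
  have hA : ∀ z, (tens (fun w => star (copyFrame (V := V) ε w : Matrix (ZMod d) (ZMod d) ℂ)) *
      ops (gatherLayer owner) : Operator d (V ⊕ P)) y z =
      tens (fun w => star (copyFrame (V := V) ε w : Matrix (ZMod d) (ZMod d) ℂ)) y (A z) := by
    intro z
    rw [ops_gatherLayer, Matrix.mul_apply, Finset.sum_eq_single (A z)]
    · simp [basisMap, A]
    · intro u _ hu
      have : ¬ u = Sum.elim (fun i => z (.inl i) + ∑ q with owner q = i, z (.inr q))
        (z ∘ Sum.inr) := hu
      simp [basisMap, this]
    · simp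
  rw [Matrix.mul_apply]
  simp only [hA, hz]
  rw [sum_basis_prod (fun w b => (d : ℂ)⁻¹ * ZMod.stdAddChar (b * c w))]
  simp only [inv_mul_sum_stdAddChar_mul, Finset.prod_ite_zero, Finset.prod_const_one,
    Finset.mem_univ, true_imp_iff, basisMap, Matrix.of_apply]
  suffices hiff : (∀ w, c w = 0) ↔ y = Sum.elim (x ∘ Sum.inl)
      fun q => x (.inr q) - ((ε⁻¹ : (ZMod d)ˣ) : ZMod d) * x (.inl (owner q)) by
    by_cases hw : ∀ w, c w = 0
    · rw [if_pos hw, if_pos (hiff.1 hw)]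
    · rw [if_neg hw, if_neg (mt hiff.2 hw)]
  rw [Sum.forall, funext_iff, Sum.forall]
  have h1 : ((ε⁻¹ : (ZMod d)ˣ) : ZMod d) * ε = 1 := by simp
  have h2 : (ε : ZMod d) * ((ε⁻¹ : (ZMod d)ˣ) : ZMod d) = 1 := by simp
  have hc : (∀ i, c (.inl i) = 0) ↔ ∀ i, y (.inl i) = x (.inl i) := forall_congr' fun i => by
    simp only [c, Sum.elim_inl, sub_eq_zero]
    exact eq_comm
  rw [hc]
  refine and_congr_right fun h => forall_congr' fun q => ?_
  simp only [c, Sum.elim_inr, h]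
  constructor
  · intro h3
    linear_combination (-((ε⁻¹ : (ZMod d)ˣ) : ZMod d)) * h3 + (x (.inr q) - y (.inr q)) * h1
  · intro h3
    linear_combination (-(ε : ZMod d)) * h3 + x (.inl (owner q)) * h2

end Copy

end Qudit

namespace Qudit

theorem coe_circle_prod {ι : Type} (s : Finset ι) (f : ι → Circle) :
    ((∏ i ∈ s, f i : Circle) : ℂ) = ∏ i ∈ s, (f i : ℂ) :=
  map_prod Circle.coeHom f s

/-! ### Pairwise diagonal operators in constant depth -/

section Diagonal

variable {d : ℕ} [NeZero d] {V : Type} [Fintype V] [DecidableEq V]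

/-- A diagonal one-qudit gate. -/
noncomputable def phaseGate (f : ZMod d → Circle) : Matrix.unitaryGroup (ZMod d) ℂ :=
  ⟨Matrix.diagonal fun b => (f b : ℂ), by
    rw [Matrix.mem_unitaryGroup_iff, Matrix.star_eq_conjTranspose, Matrix.diagonal_conjTranspose,
      Matrix.diagonal_mul_diagonal, ← Matrix.diagonal_one]
    congr 1
    ext b
    rw [Pi.star_apply, Complex.star_def, Complex.mul_conj, Circle.normSq_coe, Complex.ofReal_one]⟩

theorem phaseGate_op (S : Finset V) (v : V → ZMod d) (t : V) (ht : t ∉ S) (f : ZMod d → Circle) :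
    (Gate.ctrl S v t ht (phaseGate f)).op = Matrix.diagonal fun x =>
      ((if ∀ s ∈ S, x s = v s then f (x t) else 1 : Circle) : ℂ) := by
  ext y x
  by_cases hyx : y = x
  · subst hyx
    simp only [Gate.op, Matrix.of_apply, Matrix.diagonal_apply_eq, implies_true, if_true]
    split_ifs <;> simp [phaseGate]
  · rw [Matrix.diagonal_apply_ne _ hyx]
    simp only [Gate.op, Matrix.of_apply]
    split_ifs with h1 h2 h3
    · have : y t ≠ x t := fun h => hyx (funext fun w => by
        by_cases hw : w = t
        exacts [hw ▸ h, h1 w hw])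
      simp [phaseGate, this]
    · refine (hyx (funext fun w => ?_)).elim
      by_cases hw : w = t
      exacts [hw ▸ h3, h1 w hw]
    · rfl
    · rfl

theorem ops_map_of_diagonal {ι : Type} (g : ι → Gate d V) (f : ι → Basis d V → Circle)
    (h : ∀ i, (g i).op = Matrix.diagonal fun x => (f i x : ℂ)) (l : List ι) :
    ops (l.map g) = Matrix.diagonal fun x => (((l.map fun i => f i x).prod : Circle) : ℂ) := by
  induction l with
  | nil => simp
  | cons i l ih =>
    rw [List.map_cons, ops_cons, ih, h, Matrix.diagonal_mul_diagonal]
    congr 1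
    ext x
    simp [mul_comm]

theorem ops_flatten_of_diagonal {ι : Type} (L : ι → List (Gate d V)) (f : ι → Basis d V → Circle)
    (h : ∀ i, ops (L i) = Matrix.diagonal fun x => (f i x : ℂ)) (l : List ι) :
    ops (l.map L).flatten =
      Matrix.diagonal fun x => (((l.map fun i => f i x).prod : Circle) : ℂ) := by
  induction l with
  | nil => simp
  | cons i l ih =>
    rw [List.map_cons, List.flatten_cons, ops_append, ih, h, Matrix.diagonal_mul_diagonal]
    congr 1
    ext x
    simp [mul_comm]

/-- The wires that hold, for each pair of wires, a copy of each of the two. -/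
abbrev PairWires (V : Type) : Type := V × V × Bool

/-- The wire that is copied. -/
def pairOwner (q : PairWires V) : V := if q.2.2 then q.2.1 else q.1

/-- Two-qudit diagonal gates on the copies, restricted to the value `v` of the first copy. -/
noncomputable def pairLayer (θ : V → V → ZMod d → ZMod d → Circle) (v : ZMod d) :
    List (Gate d (V ⊕ PairWires V)) :=
  (Finset.univ : Finset (V × V)).toList.map fun p =>
    Gate.ctrl {.inr (p.1, p.2, false)} (fun _ => v) (.inr (p.1, p.2, true)) (by simp)
      (phaseGate (θ p.1 p.2 v))

theorem pairLayer_pairwise (θ : V → V → ZMod d → ZMod d → Circle) (v : ZMod d) :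
    (pairLayer θ v).Pairwise fun g h => Disjoint g.support h.support := by
  refine List.pairwise_map.2 ((Finset.nodup_toList _).imp fun {p q} h => ?_)
  rw [Finset.disjoint_left]
  intro w
  simp only [Gate.support, Finset.mem_insert, Finset.mem_singleton]
  rintro (rfl | rfl)
  · simpa [Prod.ext_iff] using h
  · simpa [Prod.ext_iff] using h

theorem pairLayer_mem (θ : V → V → ZMod d → ZMod d → Circle) (v : ZMod d) :
    ∀ g ∈ pairLayer θ v, g ∈ (iQNCGates d).withMod (V ⊕ PairWires V) := by
  intro g hg
  obtain ⟨w, -, rfl⟩ := List.mem_map.1 hg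
  left
  simp [iQNCGates]

/-- At each basis state, exactly one layer `v` matches the value of the first copy of a given pair,
so the product over `v` leaves one phase per pair. -/
theorem ops_pairLayers (θ : V → V → ZMod d → ZMod d → Circle) :
    ops ((Finset.univ : Finset (ZMod d)).toList.map (pairLayer θ)).flatten =
      Matrix.diagonal fun x => ((∏ i, ∏ j,
        θ i j (x (.inr (i, j, false))) (x (.inr (i, j, true))) : Circle) : ℂ) := by
  have h : ∀ v, ops (pairLayer θ v) = Matrix.diagonal fun x => ((∏ p : V × V,
      if x (.inr (p.1, p.2, false)) = v then θ p.1 p.2 v (x (.inr (p.1, p.2, true)))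
        else 1 : Circle) : ℂ) := by
    intro v
    rw [pairLayer, ops_map_of_diagonal _ _ fun p => phaseGate_op _ _ _ _ _]
    congr 1
    ext x
    congr 1
    rw [Finset.prod_map_toList]
    exact Finset.prod_congr rfl fun p _ => if_congr (by simp) rfl rfl
  rw [ops_flatten_of_diagonal _ _ h]
  congr 1
  ext x
  congr 1
  rw [Finset.prod_map_toList, Finset.prod_comm, Fintype.prod_prod_type]
  exact Finset.prod_congr rfl fun i _ => Finset.prod_congr rfl fun j _ => by
    rw [Finset.prod_ite_eq, if_pos (Finset.mem_univ _)]

/-- The diagonal operator with pairwise phases `θ`. -/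
noncomputable def pairDiagonal (θ : V → V → ZMod d → ZMod d → Circle) : Operator d V :=
  Matrix.diagonal fun x => ((∏ i, ∏ j, θ i j (x i) (x j) : Circle) : ℂ)

/-- The layers that shift the copies by multiples of the copied wires. -/
noncomputable def copyLayers (ε : (ZMod d)ˣ) : List (List (Gate d (V ⊕ PairWires V))) :=
  [tensLayer (copyFrame ε), gatherLayer pairOwner, tensLayer fun w => (copyFrame ε w)⁻¹]

theorem ops_copyLayers_mulVec (ε : (ZMod d)ˣ) (ψ : Basis d (V ⊕ PairWires V) → ℂ) :
    (ops (copyLayers ε).flatten).mulVec ψ = fun x => ψ (Sum.elim (x ∘ Sum.inl)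
      fun q => x (.inr q) + ((ε⁻¹ : (ZMod d)ˣ) : ZMod d) * x (.inl (pairOwner q))) := by
  have h : ops (copyLayers ε).flatten = basisMap fun x => Sum.elim (x ∘ Sum.inl) fun q =>
      x (.inr q) - ((ε⁻¹ : (ZMod d)ˣ) : ZMod d) * x (.inl (pairOwner (V := V) q)) := by
    rw [← copyFrame_conj_gather, copyLayers]
    simp only [List.flatten_cons, List.flatten_nil, List.append_nil, ops_append, ops_tensLayer]
    rfl
  rw [h, basisMap_mulVec (g := fun x => Sum.elim (x ∘ Sum.inl)
      fun q => x (.inr q) + ((ε⁻¹ : (ZMod d)ˣ) : ZMod d) * x (.inl (pairOwner q)))]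
  · rfl
  · intro x
    ext (w | w) <;> simp
  · intro x
    ext (w | w) <;> simp

theorem copyLayers_pairwise (ε : (ZMod d)ˣ) : ∀ L ∈ copyLayers (V := V) ε,
    L.Pairwise fun g h => Disjoint g.support h.support := by
  simp only [copyLayers, List.mem_cons, List.not_mem_nil, or_false]
  rintro L (rfl | rfl | rfl)
  exacts [tensLayer_pairwise _, gatherLayer_pairwise _, tensLayer_pairwise _]

theorem copyLayers_mem (ε : (ZMod d)ˣ) : ∀ L ∈ copyLayers (V := V) ε,
    ∀ g ∈ L, g ∈ (iQNCGates d).withMod (V ⊕ PairWires V) := by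
  simp only [copyLayers, List.mem_cons, List.not_mem_nil, or_false]
  rintro L (rfl | rfl | rfl)
  exacts [tensLayer_mem _, gatherLayer_mem _, tensLayer_mem _]

/-- Gates sharing a wire cannot be parallel, so every pair works on its own copies of both ends.
Three layers copy, `d` layers apply the phases (one for each value of the first copy), and three
layers erase the copies. -/
theorem Implementable.pairDiagonal (θ : V → V → ZMod d → ZMod d → Circle) :
    Implementable (X := V ⊕ PairWires V) Function.Embedding.inl (d + 6)
      (Qudit.pairDiagonal θ) := by
  refine ⟨copyLayers (-1) ++ (Finset.univ : Finset (ZMod d)).toList.map (pairLayer θ) ++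
    copyLayers 1, ?_, ?_, ?_, fun ψ => ?_⟩
  · simp [copyLayers, ZMod.card]
  · intro L hL
    simp only [List.mem_append, List.mem_map] at hL
    rcases hL with (hL | ⟨v, -, rfl⟩) | hL
    exacts [copyLayers_pairwise _ L hL, pairLayer_pairwise θ v, copyLayers_pairwise _ L hL]
  · intro L hL
    simp only [List.mem_append, List.mem_map] at hL
    rcases hL with (hL | ⟨v, -, rfl⟩) | hL
    exacts [copyLayers_mem _ L hL, pairLayer_mem θ v, copyLayers_mem _ L hL]
  · rw [List.flatten_append, List.flatten_append, ops_append, ops_append, ← Matrix.mulVec_mulVec,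
      ← Matrix.mulVec_mulVec, ops_copyLayers_mulVec, ops_copyLayers_mulVec, ops_pairLayers]
    ext y
    simp only [Matrix.mulVec_diagonal, extendZero_inl, Sum.elim_inl, Sum.elim_inr, inv_one,
      Units.val_one, one_mul, inv_neg, Units.val_neg, neg_mul, Function.comp, add_neg_cancel_right,
      Qudit.pairDiagonal]
    by_cases hy : ∀ q, y (.inr q) = 0
    · simp [hy, pairOwner]
    · simp only [if_neg hy, mul_zero]

theorem pairDiagonal_mul_inv (θ : V → V → ZMod d → ZMod d → Circle) :
    pairDiagonal (fun i j a b => (θ i j a b)⁻¹) * pairDiagonal θ = 1 := by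
  rw [pairDiagonal, pairDiagonal, Matrix.diagonal_mul_diagonal, ← Matrix.diagonal_one]
  congr 1
  ext x
  rw [← Circle.coe_mul, ← Circle.coe_one]
  simp [Finset.prod_inv_distrib]

end Diagonal

/-! ### Pairwise phases seen through Fourier transforms on the targets -/

section Stage

variable {d : ℕ} [NeZero d] {V : Type} [Fintype V] [DecidableEq V]

/-- Fourier transforms on the wires in `T`. -/
noncomputable def targetFrame (T : V → Bool) (w : V) : Matrix.unitaryGroup (ZMod d) ℂ :=
  if T w then fourier 1 else 1

/-- Pairwise phases conjugated by Fourier transforms on the wires in `T`. -/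
noncomputable def stage (T : V → Bool) (θ : V → V → ZMod d → ZMod d → Circle) : Operator d V :=
  tens (fun w => ((targetFrame (d := d) T w)⁻¹).1) * pairDiagonal θ *
    tens fun w => (targetFrame (d := d) T w).1

theorem Implementable.stage (T : V → Bool) (θ : V → V → ZMod d → ZMod d → Circle) :
    Implementable (X := V ⊕ PairWires V) Function.Embedding.inl (d + 8) (Qudit.stage T θ) :=
  (((Implementable.tens _ _).mul (.pairDiagonal θ)).mul (.tens _ _)).mono (by omega)

theorem stage_inv_mul (T : V → Bool) (θ : V → V → ZMod d → ZMod d → Circle) :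
    stage T (fun i j a b => (θ i j a b)⁻¹) * stage T θ = 1 := by
  have h1 : tens (fun w => (targetFrame (d := d) T w).1) *
      tens (fun w => ((targetFrame (d := d) T w)⁻¹).1) = 1 := by
    rw [tens_mul, ← tens_one]
    congr 1
    ext1 w
    exact congrArg Subtype.val (mul_inv_cancel (targetFrame (d := d) T w))
  have h2 : tens (fun w => ((targetFrame (d := d) T w)⁻¹).1) *
      tens (fun w => (targetFrame (d := d) T w).1) = 1 := by
    rw [tens_mul, ← tens_one]
    congr 1
    ext1 w
    exact congrArg Subtype.val (inv_mul_cancel (targetFrame (d := d) T w))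
  rw [stage, stage]
  calc _ = tens (fun w => ((targetFrame (d := d) T w)⁻¹).1) *
      (pairDiagonal (fun i j a b => (θ i j a b)⁻¹) *
      (tens (fun w => (targetFrame (d := d) T w).1) *
      tens (fun w => ((targetFrame (d := d) T w)⁻¹).1)) *
      pairDiagonal θ) * tens fun w => (targetFrame (d := d) T w).1 := by
        simp only [Matrix.mul_assoc]
    _ = 1 := by rw [h1, Matrix.mul_one, pairDiagonal_mul_inv, Matrix.mul_one, h2]

/-- A diagonal one-qudit operator conjugated by the Fourier transform. -/
noncomputable def fourierConj (f : ZMod d → Circle) : Matrix (ZMod d) (ZMod d) ℂ :=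
  Matrix.of fun y x => ∑ b, (d : ℂ)⁻¹ * (f b * ZMod.stdAddChar (b * (x - y)))

/-- The Fourier transform diagonalizes shifts: phases that form a character are a shift in disguise.
-/
theorem fourierConj_apply_of_eq {f : ZMod d → Circle} {c : ZMod d}
    (h : ∀ b, (f b : ℂ) = ZMod.stdAddChar (b * c)) (y x : ZMod d) :
    fourierConj f y x = if y = x + c then 1 else 0 := by
  have : ∀ b, (d : ℂ)⁻¹ * (f b * (ZMod.stdAddChar (b * (x - y)) : ℂ)) =
      (d : ℂ)⁻¹ * (ZMod.stdAddChar (b * (x + c - y)) : ℂ) := fun b => by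
    rw [h, ← AddChar.map_add_eq_mul]
    congr 2
    ring
  simp only [fourierConj, Matrix.of_apply, this, inv_mul_sum_stdAddChar_mul, sub_eq_zero,
    eq_comm (a := y)]

/-- Nontrivial phases go only from a wire outside `T` to a wire in `T`. The former are not
transformed and keep their values, so the sum over intermediate states factors over the targets. -/
theorem stage_apply (T : V → Bool) (θ : V → V → ZMod d → ZMod d → Circle)
    (hθ : ∀ i j, ¬ (T i = false ∧ T j = true) → θ i j = 1) (y x : Basis d V) :
    stage T θ y x = ∏ w, if T w then fourierConj (fun b => ∏ i, θ i w (x i) b) (y w) (x w)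
      else if y w = x w then 1 else 0 := by
  have hF : ∀ y b x : ZMod d, ∀ a : ℂ,
      ((fourier (1 : (ZMod d)ˣ))⁻¹ : Matrix.unitaryGroup (ZMod d) ℂ).1 y b * a *
        (fourier (1 : (ZMod d)ˣ)).1 b x =
      (d : ℂ)⁻¹ * (a * ZMod.stdAddChar (b * (x - y))) := by
    intro y b x a
    have h1 : ((fourier (1 : (ZMod d)ˣ))⁻¹ : Matrix.unitaryGroup (ZMod d) ℂ).1 y b =
      ((√d)⁻¹ : ℂ) * ZMod.stdAddChar (-(1 * b * y)) := star_fourierMatrix_apply _ _ _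
    have h2 : (fourier (1 : (ZMod d)ˣ)).1 b x =
      ((√d)⁻¹ : ℂ) * ZMod.stdAddChar (1 * b * x) := rfl
    have h3 : b * (x - y) = -(1 * b * y) + 1 * b * x := by ring
    rw [h1, h2, ← sqrt_inv_mul_self, h3, AddChar.map_add_eq_mul]
    ring
  let h : V → ZMod d → ℂ := fun w b =>
    ((targetFrame (d := d) T w)⁻¹).1 (y w) b *
      ((if T w then ∏ i, θ i w (x i) b else 1 : Circle) : ℂ) * (targetFrame T w).1 b (x w)
  have hz : ∀ z : Basis d V,
      tens (fun w => ((targetFrame (d := d) T w)⁻¹).1) y z *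
        ((∏ i, ∏ j, θ i j (z i) (z j) : Circle) : ℂ) *
        tens (fun w => (targetFrame (d := d) T w).1) z x = ∏ w, h w (z w) := by
    intro z
    simp only [h, Finset.prod_mul_distrib, tens, Matrix.of_apply]
    -- Off `T` the frame is the identity. A state `z` differing from `x` there contributes `0` to
    -- both sides; for the others `x i` may replace `z i` in the phases.
    by_cases hzx : ∀ w, T w = false → z w = x w
    · congr 2
      rw [Finset.prod_comm, coe_circle_prod]
      refine Finset.prod_congr rfl fun w _ => ?_
      congr 1
      by_cases hw : T w = true
      · rw [if_pos hw]
        refine Finset.prod_congr rfl fun i _ => ?_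
        by_cases hi : T i = false
        · rw [hzx i hi]
        · rw [hθ i w fun h => hi h.1]; rfl
      · rw [if_neg hw]
        refine Finset.prod_eq_one fun i _ => ?_
        rw [hθ i w fun h => hw h.2]; rfl
    · push Not at hzx
      obtain ⟨w, hw, hne⟩ := hzx
      have : ∏ w, (targetFrame T w).1 (z w) (x w) = 0 :=
        Finset.prod_eq_zero (Finset.mem_univ w) (by simp [targetFrame, hw, hne])
      rw [this, mul_zero, mul_zero]
  rw [stage, Matrix.mul_apply]
  simp only [pairDiagonal, Matrix.mul_diagonal, hz]
  rw [sum_basis_prod]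
  refine Finset.prod_congr rfl fun w _ => ?_
  by_cases hw : T w = true
  · simp only [h, targetFrame, hw, if_true, hF, fourierConj, Matrix.of_apply]
  · simp [h, targetFrame, hw, Matrix.one_apply, eq_comm (a := x w)]

/-- A stage that shifts the target wires by the values of a function of the other wires. -/
theorem stage_mulVec_of_shift (T : V → Bool) (θ : V → V → ZMod d → ZMod d → Circle)
    (hθ : ∀ i j, ¬ (T i = false ∧ T j = true) → θ i j = 1) (f : Basis d V → Basis d V)
    (hf : ∀ x w, T w = false → f x w = 0)
    (hf' : ∀ x y, (∀ w, T w = false → x w = y w) → f x = f y) (φ : Basis d V → ℂ)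
    (hφ : ∀ x, φ x ≠ 0 → ∀ w, T w = true →
      ∀ b, ((∏ i, θ i w (x i) b : Circle) : ℂ) = ZMod.stdAddChar (b * f x w)) :
    (stage T θ).mulVec φ = fun y => φ (y - f y) := by
  ext y
  rw [Matrix.mulVec, dotProduct]
  have h : ∀ x, stage T θ y x * φ x = if y = x + f x then φ x else 0 := by
    intro x
    -- The phases need to form characters only on the support of `φ`; elsewhere the entry of the
    -- stage is multiplied by `0`.
    by_cases hx : φ x = 0
    · simp [hx]
    · rw [stage_apply T θ hθ]
      have : ∀ w, (if T w then fourierConj (fun b => ∏ i, θ i w (x i) b) (y w) (x w)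
          else if y w = x w then 1 else 0) = if y w = x w + f x w then (1 : ℂ) else 0 := by
        intro w
        by_cases hw : T w = true
        · rw [if_pos hw, fourierConj_apply_of_eq (hφ x hx w hw)]
        · rw [if_neg hw, hf x w (by simpa using hw), add_zero]
      simp only [this, Finset.prod_ite_zero, Finset.mem_univ, true_imp_iff, Finset.prod_const_one,
        funext_iff, Pi.add_apply, ite_mul, one_mul, zero_mul]
  simp only [h]
  -- The shift `f` reads only wires that it does not move, so subtracting it inverts adding it.
  have hiff : ∀ x, y = x + f x ↔ x = y - f y := by
    intro x
    constructor
    · intro hx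
      rw [hf' y x fun w hw => by rw [hx, Pi.add_apply, hf x w hw, add_zero], hx,
        add_sub_cancel_right]
    · intro hx
      rw [hf' x y fun w hw => by rw [hx, Pi.sub_apply, hf y w hw, sub_zero], hx, sub_add_cancel]
  rw [Finset.sum_eq_single (y - f y)]
  · rw [if_pos ((hiff _).2 rfl)]
  · intro x _ hx
    rw [if_neg (mt (hiff x).1 hx)]
  · simp

end Stage

end Qudit

namespace Qudit

/-! ### Gates acting through answer wires -/

section Local

variable {d : ℕ} [NeZero d] {W A : Type} [DecidableEq W] [DecidableEq A]

/-- The wires that a gate modifies. -/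
def Gate.targets : Gate d W → Finset W
  | .ctrl _ _ t _ _ => {t}
  | .qmod _ t _ => {t}
  | .cfanout _ T _ => T

/-- The gates that simulate a gate when the information that it needs about the other wires is
available, for each target `t`, in the wire `b t`. -/
noncomputable def Gate.localize (b : W → A) : Gate d W → List (Gate d (W ⊕ A))
  | .ctrl _ _ t _ U => [.ctrl {.inr (b t)} 0 (.inl t) (by simp) U]
  | .qmod S t ht => [(Gate.qmod S t ht).map Function.Embedding.inl]
  | .cfanout _ T _ => T.toList.map fun t => .qmod {.inr (b t)} (.inl t) (by simp)

/-- The amplitudes `Φ` are unaffected by the gate `g` and make the information that `g` needs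
available in the wires `b t`. -/
def Gate.Loaded (b : W → A) (Φ : Basis d (W ⊕ A) → ℂ) (g : Gate d W) : Prop :=
  (∀ y y' : Basis d (W ⊕ A), (∀ q, y (.inr q) = y' (.inr q)) →
    (∀ w, w ∉ g.targets → y (.inl w) = y' (.inl w)) → Φ y = Φ y') ∧
  match g with
  | .ctrl S v t _ _ => ∀ y, Φ y ≠ 0 → (y (.inr (b t)) = 0 ↔ ∀ s ∈ S, y (.inl s) = v s)
  | .qmod _ _ _ => True
  | .cfanout c T _ => ∀ y, Φ y ≠ 0 → ∀ t ∈ T, y (.inr (b t)) = y (.inl c)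

theorem Gate.localize_mem (b : W → A) (g : Gate d W) :
    ∀ h ∈ g.localize b, h ∈ (iQNCGates d).withMod (W ⊕ A) := by
  intro h hh
  cases g with
  | ctrl S v t ht U =>
    rw [Gate.localize, List.mem_singleton] at hh
    subst hh
    left
    simp [iQNCGates]
  | qmod S t ht =>
    rw [Gate.localize, List.mem_singleton] at hh
    subst hh
    exact Or.inr ⟨_, _, _, rfl⟩
  | cfanout c T hc =>
    obtain ⟨t, -, rfl⟩ := List.mem_map.1 hh
    exact Or.inr ⟨_, _, _, rfl⟩

/-- The wires used for the simulation of a gate. -/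
def Gate.localSupport (b : W → A) (g : Gate d W) : Finset (W ⊕ A) :=
  g.support.image Sum.inl ∪ g.support.image fun w => Sum.inr (b w)

theorem Gate.support_subset_of_mem_localize {b : W → A} {g : Gate d W} {h : Gate d (W ⊕ A)}
    (hh : h ∈ g.localize b) : h.support ⊆ g.localSupport b := by
  cases g with
  | ctrl S v t ht U =>
    rw [Gate.localize, List.mem_singleton] at hh
    subst hh
    simp [Gate.support, Gate.localSupport, Finset.insert_subset_iff]
  | qmod S t ht =>
    rw [Gate.localize, List.mem_singleton] at hh
    subst hh
    rw [Gate.support_map, Finset.map_eq_image]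
    exact Finset.subset_union_left
  | cfanout c T hc =>
    obtain ⟨t, ht, rfl⟩ := List.mem_map.1 hh
    rw [Finset.mem_toList] at ht
    simp only [Gate.support, Gate.localSupport, Finset.insert_subset_iff, Finset.mem_union,
      Finset.mem_image, Finset.mem_insert, Finset.singleton_subset_iff]
    exact ⟨Or.inl ⟨t, Or.inr ht, rfl⟩, Or.inr ⟨t, Or.inr ht, rfl⟩⟩

theorem Gate.disjoint_localSupport {b : W → A} (hb : Function.Injective b) {g h : Gate d W}
    (hgh : Disjoint g.support h.support) : Disjoint (g.localSupport b) (h.localSupport b) := by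
  rw [Finset.disjoint_left] at hgh ⊢
  rintro (w | w)
  · simpa [Gate.localSupport] using @hgh w
  · simp only [Gate.localSupport, Finset.mem_union, Finset.mem_image]
    rintro (⟨u, -, hu⟩ | ⟨u, hu, hu'⟩) (⟨v, -, hv⟩ | ⟨v, hv, hv'⟩)
    · cases hu
    · cases hu
    · cases hv
    · rw [← hu'] at hv'
      exact hgh hu (hb (Sum.inr_injective hv') ▸ hv)

theorem Gate.localize_pairwise {b : W → A} (hb : Function.Injective b) (g : Gate d W) :
    (g.localize b).Pairwise fun g h => Disjoint g.support h.support := by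
  cases g with
  | ctrl S v t ht U => exact List.pairwise_singleton _ _
  | qmod S t ht => exact List.pairwise_singleton _ _
  | cfanout c T hc =>
    refine List.pairwise_map.2 ((Finset.nodup_toList _).imp fun {t u} h => ?_)
    rw [Finset.disjoint_left]
    intro w
    simp only [Gate.support, Finset.mem_insert, Finset.mem_singleton]
    rintro (rfl | rfl)
    · simpa using h
    · simpa using hb.ne h

theorem localize_layer_pairwise {b : W → A} (hb : Function.Injective b) {L : List (Gate d W)}
    (hL : L.Pairwise fun g h => Disjoint g.support h.support) :
    (L.flatMap (Gate.localize b)).Pairwise fun g h => Disjoint g.support h.support := by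
  refine List.pairwise_flatMap.2 ⟨fun g _ => g.localize_pairwise hb, hL.imp fun h g' hg' h' hh' => ?_⟩
  exact (Gate.disjoint_localSupport hb h).mono (Gate.support_subset_of_mem_localize hg')
    (Gate.support_subset_of_mem_localize hh')

variable [Fintype W] [Fintype A]

theorem update_inl_comp_inl (y : Basis d (W ⊕ A)) (t : W) (u : ZMod d) :
    (Function.update y (.inl t) u) ∘ Sum.inl = Function.update (y ∘ Sum.inl) t u :=
  Function.update_comp_eq_of_injective _ Sum.inl_injective _ _

/-- The factor `Φ` is constant along the wires that `g` changes, so it can be pulled out of the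
action. Where it is nonzero, the answer wires agree with what `g` reads. No product structure
between `ψ` and `Φ` is required. -/
theorem Gate.localize_mulVec {b : W → A} {Φ : Basis d (W ⊕ A) → ℂ} {g : Gate d W}
    (hg : g.Loaded b Φ) (ψ : Basis d W → ℂ) :
    (ops (g.localize b)).mulVec (fun y => ψ (y ∘ Sum.inl) * Φ y) =
      fun y => g.op.mulVec ψ (y ∘ Sum.inl) * Φ y := by
  obtain ⟨hinv, hg⟩ := hg
  ext y
  have hupd : ∀ t, t ∈ g.targets → ∀ u, Φ (Function.update y (.inl t) u) = Φ y := by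
    intro t ht u
    refine hinv _ _ (fun q => by simp) fun w hw => ?_
    rw [Function.update_of_ne]
    rintro h
    exact hw (Sum.inl_injective h ▸ ht)
  cases g with
  | ctrl S v t ht U =>
    rw [Gate.localize, ops_cons, ops_nil, Matrix.one_mul, ctrl_mulVec, ctrl_mulVec]
    simp only [hupd t (Finset.mem_singleton_self t), update_inl_comp_inl, ← mul_assoc,
      ← Finset.sum_mul, Finset.mem_singleton, forall_eq, Pi.zero_apply, Function.comp]
    by_cases hΦ : Φ y = 0
    · simp [hΦ]
    · by_cases h : ∀ s ∈ S, y (.inl s) = v s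
      · rw [if_pos ((hg y hΦ).2 h), if_pos h]
      · rw [if_neg (mt (hg y hΦ).1 h), if_neg h]
  | qmod S t ht =>
    rw [Gate.localize, ops_cons, ops_nil, Matrix.one_mul, Gate.map, qmod_mulVec, qmod_mulVec]
    simp only [Function.Embedding.inl_apply, hupd t (Finset.mem_singleton_self t),
      update_inl_comp_inl, Finset.sum_map, Function.comp]
  | cfanout c T hc =>
    -- The localized fanout is a list of `qMOD` gates with one summand each, taken from the answer
    -- wires, so `ops_qmod_list` applies.
    let S : W ⊕ A → Finset (W ⊕ A) := Sum.elim (fun t => {.inr (b t)}) fun _ => ∅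
    have hS : ∀ i, i ∉ S i := by rintro (i | i) <;> simp [S]
    have h1 : (Gate.cfanout (d := d) c T hc).localize b =
        (T.toList.map Sum.inl).map fun i => Gate.qmod (S i) i (hS i) := by
      rw [List.map_map]; rfl
    have h2 : ops ((Gate.cfanout (d := d) c T hc).localize b) = basisMap fun x => Sum.elim
        (fun t => if t ∈ T then x (.inl t) + x (.inr (b t)) else x (.inl t)) (x ∘ Sum.inr) := by
      rw [h1, ops_qmod_list]
      · congr 1
        ext x w
        cases w <;> simp [S]
      · exact (Finset.nodup_toList _).map Sum.inl_injective
      · intro i hi j hj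
        obtain ⟨i, -, rfl⟩ := List.mem_map.1 hi
        obtain ⟨j, -, rfl⟩ := List.mem_map.1 hj
        simp [S]
    rw [h2, basisMap_mulVec (g := fun x => Sum.elim
      (fun t => if t ∈ T then x (.inl t) - x (.inr (b t)) else x (.inl t)) (x ∘ Sum.inr)),
      cfanout_mulVec]
    · have hΦ : Φ (Sum.elim (fun t => if t ∈ T then y (.inl t) - y (.inr (b t)) else y (.inl t))
          (y ∘ Sum.inr)) = Φ y := by
        refine hinv _ _ (fun q => by simp) fun w hw => ?_
        have : w ∉ T := hw
        simp [this]
      rw [Function.comp, hΦ]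
      by_cases h0 : Φ y = 0
      · simp [h0]
      · congr 2
        ext w
        by_cases hw : w ∈ T
        · simp [hw, hg y h0 w hw]
        · simp [hw]
    · intro x
      ext (w | w)
      · by_cases hw : w ∈ T <;> simp [hw]
      · simp
    · intro x
      ext (w | w)
      · by_cases hw : w ∈ T <;> simp [hw]
      · simp

theorem localize_layer_mulVec {b : W → A} {Φ : Basis d (W ⊕ A) → ℂ} {L : List (Gate d W)}
    (hL : ∀ g ∈ L, g.Loaded b Φ) (ψ : Basis d W → ℂ) :
    (ops (L.flatMap (Gate.localize b))).mulVec (fun y => ψ (y ∘ Sum.inl) * Φ y) =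
      fun y => (ops L).mulVec ψ (y ∘ Sum.inl) * Φ y := by
  induction L generalizing ψ with
  | nil => simp
  | cons g L ih =>
    rw [List.flatMap_cons, ops_append, ← Matrix.mulVec_mulVec,
      Gate.localize_mulVec (hL g (List.mem_cons_self ..)),
      ih fun g hg => hL g (List.mem_cons_of_mem _ hg), ops_cons, ← Matrix.mulVec_mulVec]

end Local

end Qudit

namespace Qudit

/-! ### Linear forms over `ℤ/p` and exact rotations -/

section Counting

variable {p : ℕ} [Fact p.Prime]

/-- Translating `s` along a coordinate where `z` is invertible permutes the fibres of `s ↦ ∑ j, s j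
* z j`, so all `p` of them have the same size. -/
theorem mul_card_dot_eq_zero {m : ℕ} {z : Fin m → ZMod p} (hz : z ≠ 0) :
    p * (Finset.univ.filter fun s : Fin m → ZMod p => ∑ j, s j * z j = 0).card = p ^ m := by
  obtain ⟨i, hi⟩ := Function.ne_iff.1 hz
  have h : ∀ c : ZMod p, (Finset.univ.filter fun s : Fin m → ZMod p => ∑ j, s j * z j = c).card =
      (Finset.univ.filter fun s : Fin m → ZMod p => ∑ j, s j * z j = 0).card := by
    intro c
    have hs : ∀ (s : Fin m → ZMod p) (a : ZMod p),
        ∑ j, (s + Pi.single i a : Fin m → ZMod p) j * z j = ∑ j, s j * z j + a * z i := by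
      intro s a
      simp [add_mul, Finset.sum_add_distrib, Pi.single_apply]
    have hi' : z i ≠ 0 := hi
    refine Finset.card_bij' (fun s _ => s + Pi.single i (-(c / z i)))
      (fun s _ => s + Pi.single i (c / z i)) ?_ ?_ ?_ ?_
    · intro s hs'
      simp only [Finset.mem_filter, Finset.mem_univ, true_and, hs] at hs' ⊢
      rw [hs']
      field_simp
      ring
    · intro s hs'
      simp only [Finset.mem_filter, Finset.mem_univ, true_and, hs] at hs' ⊢
      rw [hs']
      field_simp
      ring
    · intro s _
      rw [add_assoc, ← Pi.single_add]
      simp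
    · intro s _
      rw [add_assoc, ← Pi.single_add]
      simp
  have hc := Finset.card_eq_sum_card_fiberwise (s := (Finset.univ : Finset (Fin m → ZMod p)))
    (t := Finset.univ) (f := fun s => ∑ j, s j * z j) (fun _ _ => Finset.mem_coe.2 (Finset.mem_univ _))
  simp only [h, Finset.sum_const, Finset.card_univ, Fintype.card_fun, ZMod.card, Fintype.card_fin,
    smul_eq_mul] at hc
  exact hc.symm

/-- The number of linear forms on `(ℤ/p)^m` that do not vanish at a given nonzero vector. -/
def formCount (p m : ℕ) : ℕ := p ^ m - p ^ m / p

/-- The count is independent of `z`. This is what lets a fixed angle per nonvanishing form add up to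
exactly `1 / p`. -/
theorem card_dot_ne_zero {m : ℕ} {z : Fin m → ZMod p} (hz : z ≠ 0) :
    (Finset.univ.filter fun s : Fin m → ZMod p => ∑ j, s j * z j ≠ 0).card = formCount p m := by
  have h1 := mul_card_dot_eq_zero hz
  have h2 := Finset.card_filter_add_card_filter_not (s := (Finset.univ : Finset (Fin m → ZMod p)))
    (fun s => ∑ j, s j * z j = 0)
  have hp : 0 < p := (Fact.out : p.Prime).pos
  have h3 : (Finset.univ.filter fun s : Fin m → ZMod p => ∑ j, s j * z j = 0).card = p ^ m / p := by
    rw [← h1, Nat.mul_div_cancel_left _ hp]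
  simp only [Finset.card_univ, Fintype.card_fun, ZMod.card, Fintype.card_fin] at h2
  rw [formCount, ← h3, ← h2, Nat.add_sub_cancel_left]

theorem formCount_ne_zero {m : ℕ} {z : Fin m → ZMod p} (hz : z ≠ 0) : formCount p m ≠ 0 := by
  have h1 := mul_card_dot_eq_zero hz
  have hp := (Fact.out : p.Prime).one_lt
  have : p ^ m / p < p ^ m := Nat.div_lt_self (Nat.pow_pos hp.le) hp
  rw [formCount]
  omega

/-- The phase `exp (2 π i b r)`. -/
noncomputable def phase (r : ℝ) (b : ZMod p) : Circle := Circle.exp (2 * Real.pi * (b.val * r))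

theorem phase_pow (r : ℝ) (b : ZMod p) (k : ℕ) : phase r b ^ k = phase (k * r) b := by
  ext
  rw [phase, phase, Circle.coe_pow, Circle.coe_exp, Circle.coe_exp, ← Complex.exp_nat_mul]
  congr 1
  push_cast
  ring

/-- Angles in multiples of `1 / p` are the ones that give characters, hence exact shifts. -/
theorem phase_natCast_div (u : ℕ) (b : ZMod p) :
    (phase (u / p) b : ℂ) = ZMod.stdAddChar (b * (u : ZMod p)) := by
  have : b * (u : ZMod p) = ((b.val * u : ℕ) : ZMod p) := by
    rw [Nat.cast_mul, ZMod.natCast_zmod_val]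
  rw [this, ZMod.stdAddChar_apply, ZMod.toCircle_natCast, phase, Circle.coe_exp]
  congr 1
  push_cast
  ring

/-- Rotation by all the angles `k / p ^ (j + 1)`, `j < m`, distinguishes `k = 0` from
`0 < k < p ^ m`. -/
theorem fourierConj_phase_ne_zero {m k : ℕ} (hk : k < p ^ m) {z : Fin m → ZMod p}
    (hz : ∀ j : Fin m, fourierConj (fun b => phase (k * (1 / (p : ℝ) ^ (j.val + 1))) b) (z j) 0 ≠ 0) :
    z = 0 ↔ k = 0 := by
  have hp : p.Prime := Fact.out
  have hp0 : (p : ℝ) ≠ 0 := Nat.cast_ne_zero.2 hp.ne_zero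
  constructor
  · rintro rfl
    by_contra hk0
    -- Here `j` is the `p`-adic valuation of `k`. The angle `k / p ^ (j + 1)` is `u / p`, so qudit
    -- `j` is shifted by `u`, nonzero modulo `p`, and its amplitude at `0` vanishes. The bound `k <
    -- p ^ m` ensures `j < m`.
    obtain ⟨j, u, hu, rfl⟩ := Nat.exists_eq_pow_mul_and_not_dvd hk0 p hp.ne_one
    have hu0 : u ≠ 0 := by rintro rfl; exact hu (dvd_zero p)
    have hj : j < m := by
      rw [← Nat.pow_lt_pow_iff_right hp.one_lt]
      exact (Nat.le_mul_of_pos_right _ (Nat.pos_of_ne_zero hu0)).trans_lt hk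
    have hr : ((p ^ j * u : ℕ) : ℝ) * (1 / (p : ℝ) ^ (j + 1)) = u / p := by
      push_cast
      field_simp
      ring
    refine hz ⟨j, hj⟩ ?_
    simp only [hr]
    rw [fourierConj_apply_of_eq (phase_natCast_div u), if_neg]
    rw [Pi.zero_apply, zero_add]
    exact fun h => hu ((ZMod.natCast_eq_zero_iff u p).1 h.symm)
  · rintro rfl
    ext j
    have h := hz j
    have hr : ∀ b : ZMod p, (phase (((0 : ℕ) : ℝ) * (1 / (p : ℝ) ^ (j.val + 1))) b : ℂ) =
        ZMod.stdAddChar (b * 0) := fun b => by simp [phase]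
    rw [fourierConj_apply_of_eq hr] at h
    by_contra h0
    exact h (if_neg (by simpa using h0))

end Counting

/-! ### Loading the answers to queries into auxiliary wires -/

section Loading

variable {p : ℕ} [Fact p.Prime] {W : Type} [Fintype W] [DecidableEq W] (m : ℕ)

/-- The auxiliary wires: for each wire `m` rotated qudits, one qudit for each linear form in
these, and one qudit for the result. -/
abbrev Aux (p : ℕ) (W : Type) (m : ℕ) : Type := W × (Fin m ⊕ (Fin m → ZMod p) ⊕ Unit)

instance : DecidableEq (Aux p W m) := inferInstance

/-- What is to be loaded for a wire: whether the wires in `conds` carry the values `vals`, and the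
sum of the wires in `srcs`. -/
structure Query (p : ℕ) (W : Type) where
  conds : Finset W
  vals : W → ZMod p
  srcs : Finset W

/-- The number of violated conditions. -/
def Query.mismatches (Q : Query p W) (x : Basis p W) : ℕ :=
  (Q.conds.filter fun s => x s ≠ Q.vals s).card

/-- The loaded value. -/
def Query.value (Q : Query p W) (x : Basis p W) : ZMod p :=
  (if Q.mismatches x = 0 then 0 else 1) + ∑ s ∈ Q.srcs, x s

variable (Q : W → Query p W)

abbrev AuxWire (p : ℕ) (W : Type) (m : ℕ) : Type := W ⊕ Aux p W m

def rotTarget : AuxWire p W m → Bool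
  | .inr (_, .inl _) => true
  | _ => false

def formTarget : AuxWire p W m → Bool
  | .inr (_, .inr (.inl _)) => true
  | _ => false

def resTarget : AuxWire p W m → Bool
  | .inr (_, .inr (.inr _)) => true
  | _ => false

/-- All violated conditions turn the same qudit by the same angle, so only their number matters. -/
noncomputable def rotPhase : AuxWire p W m → AuxWire p W m → ZMod p → ZMod p → Circle
  | .inl i, .inr (w, .inl j) => fun a b =>
      if i ∈ (Q w).conds ∧ a ≠ (Q w).vals i then phase (1 / (p : ℝ) ^ (j.val + 1)) b else 1
  | _, _ => 1

/-- In the Fourier frame this adds `s j * a` to the qudit of the form `s`. -/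
noncomputable def formPhase : AuxWire p W m → AuxWire p W m → ZMod p → ZMod p → Circle
  | .inr (w, .inl j), .inr (w', .inr (.inl s)) => fun a b =>
      if w = w' then ZMod.toCircle (b * (s j * a)) else 1
  | _, _ => 1

/-- Each nonvanishing form supplies the fraction `1 / formCount p m` of a shift by `1`; the second
branch adds the sources. -/
noncomputable def resPhase : AuxWire p W m → AuxWire p W m → ZMod p → ZMod p → Circle
  | .inr (w, .inr (.inl _)), .inr (w', .inr (.inr _)) => fun a b =>
      if w = w' ∧ a ≠ 0 then phase (1 / (formCount p m * p : ℝ)) b else 1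
  | .inl i, .inr (w, .inr (.inr _)) => fun a b =>
      if i ∈ (Q w).srcs then ZMod.toCircle (b * a) else 1
  | _, _ => 1

def formShift (y : Basis p (AuxWire p W m)) : Basis p (AuxWire p W m)
  | .inr (w, .inr (.inl s)) => ∑ j, s j * y (.inr (w, .inl j))
  | _ => 0

def resShift (y : Basis p (AuxWire p W m)) : Basis p (AuxWire p W m)
  | .inr (w, .inr (.inr _)) => (Q w).value (y ∘ Sum.inl)
  | _ => 0

theorem rotPhase_eq_one (i j : AuxWire p W m)
    (h : ¬ (rotTarget m i = false ∧ rotTarget m j = true)) : rotPhase m Q i j = 1 := by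
  rcases i with i | ⟨w, i | i | i⟩ <;> rcases j with j | ⟨w', j | j | j⟩ <;>
    first | rfl | exact (h ⟨rfl, rfl⟩).elim

theorem formPhase_eq_one (i j : AuxWire p W m)
    (h : ¬ (formTarget m i = false ∧ formTarget m j = true)) : formPhase m i j = 1 := by
  rcases i with i | ⟨w, i | i | i⟩ <;> rcases j with j | ⟨w', j | j | j⟩ <;>
    first | rfl | exact (h ⟨rfl, rfl⟩).elim

theorem resPhase_eq_one (i j : AuxWire p W m)
    (h : ¬ (resTarget m i = false ∧ resTarget m j = true)) : resPhase m Q i j = 1 := by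
  rcases i with i | ⟨w, i | i | i⟩ <;> rcases j with j | ⟨w', j | j | j⟩ <;>
    first | rfl | exact (h ⟨rfl, rfl⟩).elim

theorem prod_rotPhase (x : Basis p (AuxWire p W m)) (w : W) (j : Fin m) (b : ZMod p) :
    ∏ i, rotPhase m Q i (.inr (w, .inl j)) (x i) b =
      phase ((Q w).mismatches (x ∘ Sum.inl) * (1 / (p : ℝ) ^ (j.val + 1))) b := by
  rw [← phase_pow, Fintype.prod_sum_type]
  have h : ∏ q, rotPhase m Q (.inr q) (.inr (w, .inl j)) (x (.inr q)) b = 1 :=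
    Finset.prod_eq_one fun q _ => rfl
  rw [h, mul_one]
  simp only [rotPhase]
  rw [← Finset.prod_filter, Finset.prod_const, Query.mismatches]
  congr 2
  ext s
  simp

theorem prod_formPhase (x : Basis p (AuxWire p W m)) (w : W) (s : Fin m → ZMod p) (b : ZMod p) :
    ∏ i, formPhase m i (.inr (w, .inr (.inl s))) (x i) b =
      ZMod.toCircle (b * formShift m x (.inr (w, .inr (.inl s)))) := by
  rw [Fintype.prod_sum_type]
  have h : ∏ i, formPhase m (.inl i) (.inr (w, .inr (.inl s))) (x (.inl i)) b = 1 :=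
    Finset.prod_eq_one fun q _ => rfl
  rw [h, one_mul, Fintype.prod_prod_type, Finset.prod_eq_single w]
  · rw [Fintype.prod_sum_type]
    have h : ∏ i, formPhase m (.inr (w, .inr i)) (.inr (w, .inr (.inl s)))
        (x (.inr (w, .inr i))) b = 1 := Finset.prod_eq_one fun q _ => rfl
    rw [h, mul_one]
    simp only [formPhase, formShift, if_true]
    ext
    rw [coe_circle_prod, Finset.mul_sum]
    exact (stdAddChar_sum _ _).symm
  · intro w' _ hw
    refine Finset.prod_eq_one fun q _ => ?_
    rcases q with j | q
    · exact if_neg hw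
    · rfl
  · simp

/-- The hypotheses describe the states reached after the first two stages. If `z = 0`, no form
contributes; otherwise exactly `formCount p m` of them do, and the total angle is `1 / p`. The
existence of a nonzero `z` also shows that the normalizing factor is nonzero. -/
theorem prod_resPhase (x : Basis p (AuxWire p W m)) (w : W) (u : Unit) (b : ZMod p)
    (hx : ∀ s, x (.inr (w, .inr (.inl s))) = ∑ j, s j * x (.inr (w, .inl j)))
    (hx' : (fun j => x (.inr (w, .inl j))) = (0 : Fin m → ZMod p) ↔
      (Q w).mismatches (x ∘ Sum.inl) = 0) :
    ((∏ i, resPhase m Q i (.inr (w, .inr (.inr u))) (x i) b : Circle) : ℂ) =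
      ZMod.stdAddChar (b * resShift m Q x (.inr (w, .inr (.inr u)))) := by
  have h1 : ((∏ i, resPhase m Q (.inl i) (.inr (w, .inr (.inr u))) (x (.inl i)) b : Circle) : ℂ) =
      ZMod.stdAddChar (b * ∑ s ∈ (Q w).srcs, (x ∘ Sum.inl) s) := by
    simp only [resPhase]
    rw [Finset.prod_ite_mem, Finset.univ_inter, coe_circle_prod, Finset.mul_sum, stdAddChar_sum]
    rfl
  have h2 : ((∏ q, resPhase m Q (.inr q) (.inr (w, .inr (.inr u))) (x (.inr q)) b : Circle) : ℂ) =
      ZMod.stdAddChar (b * if (Q w).mismatches (x ∘ Sum.inl) = 0 then 0 else 1) := by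
    rw [Fintype.prod_prod_type, Finset.prod_eq_single w]
    · rw [Fintype.prod_sum_type, Fintype.prod_sum_type]
      have h : ∏ j, resPhase m Q (.inr (w, .inl j)) (.inr (w, .inr (.inr u)))
        (x (.inr (w, .inl j))) b = 1 := Finset.prod_eq_one fun q _ => rfl
      have h' : ∏ j, resPhase m Q (.inr (w, .inr (.inr j))) (.inr (w, .inr (.inr u)))
        (x (.inr (w, .inr (.inr j)))) b = 1 := Finset.prod_eq_one fun q _ => rfl
      rw [h, h', one_mul, mul_one]
      simp only [resPhase, true_and, hx]
      rw [← Finset.prod_filter, Finset.prod_const, phase_pow]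
      by_cases hm : (Q w).mismatches (x ∘ Sum.inl) = 0
      · have hz := hx'.2 hm
        have hz' : ∀ j, x (.inr (w, .inl j)) = 0 := fun j => congrFun hz j
        simp [hm, hz', phase]
      · have hz := mt hx'.1 hm
        have hr : (formCount p m : ℝ) * (1 / (formCount p m * p)) = ((1 : ℕ) : ℝ) / p := by
          have := formCount_ne_zero hz
          field_simp
          simp
        rw [card_dot_ne_zero hz, if_neg hm, hr, phase_natCast_div, Nat.cast_one]
    · intro w' _ hw
      refine Finset.prod_eq_one fun q _ => ?_
      rcases q with j | q | q
      · rfl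
      · exact if_neg fun h => hw h.1
      · rfl
    · simp
  rw [Fintype.prod_sum_type, Circle.coe_mul, h1, h2, ← AddChar.map_add_eq_mul, ← mul_add]
  congr 2
  rw [resShift, Query.value, add_comm]

/-- The operator that loads the answers to the queries into the auxiliary wires. -/
noncomputable def load : Operator p (AuxWire p W m) :=
  stage (V := AuxWire p W m) (resTarget m) (resPhase m Q) *
    stage (V := AuxWire p W m) (formTarget m) (formPhase m) *
    stage (V := AuxWire p W m) (rotTarget m) (rotPhase m Q)

/-- The inverse of `load`. -/
noncomputable def unload : Operator p (AuxWire p W m) :=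
  stage (V := AuxWire p W m) (rotTarget m) (fun i j a b => (rotPhase m Q i j a b)⁻¹) *
    stage (V := AuxWire p W m) (formTarget m) (fun i j a b => (formPhase m i j a b)⁻¹) *
    stage (V := AuxWire p W m) (resTarget m) (fun i j a b => (resPhase m Q i j a b)⁻¹)

theorem unload_mul_load : unload m Q * load m Q = 1 := by
  have h : ∀ a b c a' b' c' : Operator p (AuxWire p W m), a' * a = 1 → b' * b = 1 → c' * c = 1 →
      a' * b' * c' * (c * b * a) = 1 := by
    intro a b c a' b' c' ha hb hc
    calc a' * b' * c' * (c * b * a) = a' * (b' * (c' * c) * b) * a := by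
          simp only [Matrix.mul_assoc]
      _ = 1 := by rw [hc, Matrix.mul_one, hb, Matrix.mul_one, ha]
  exact h _ _ _ _ _ _ (stage_inv_mul _ _) (stage_inv_mul _ _) (stage_inv_mul _ _)

/-- The amplitudes of the rotated qudits. -/
noncomputable def rotAmplitude (y : Basis p (AuxWire p W m)) : ℂ :=
  stage (V := AuxWire p W m) (rotTarget m) (rotPhase m Q) y (Sum.elim (y ∘ Sum.inl) 0)

/-- The amplitudes of the auxiliary wires after loading. -/
noncomputable def loadAmplitude (y : Basis p (AuxWire p W m)) : ℂ :=
  rotAmplitude m Q (y - resShift m Q y - formShift m (y - resShift m Q y))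

theorem rotAmplitude_eq (y : Basis p (AuxWire p W m)) :
    rotAmplitude m Q y = ∏ q : Aux p W m, if rotTarget m (.inr q) then
      fourierConj (fun b => ∏ i, rotPhase m Q i (.inr q) (Sum.elim (y ∘ Sum.inl) 0 i) b) (y (.inr q)) 0
      else if y (.inr q) = 0 then 1 else 0 := by
  rw [rotAmplitude, stage_apply _ _ (rotPhase_eq_one m Q), Fintype.prod_sum_type]
  have h : ∏ i : W, (if rotTarget (p := p) m (.inl i) = true then
      fourierConj (fun b => ∏ k, rotPhase m Q k (.inl i) (Sum.elim (y ∘ Sum.inl) 0 k) b)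
        (y (.inl i)) (Sum.elim (y ∘ Sum.inl) (0 : Aux p W m → ZMod p) (.inl i))
      else if y (.inl i) = Sum.elim (y ∘ Sum.inl) (0 : Aux p W m → ZMod p) (.inl i)
        then (1 : ℂ) else 0) = 1 :=
    Finset.prod_eq_one fun i _ => by simp [rotTarget]
  rw [h, one_mul]
  rfl

/-- There are at most `Fintype.card W` mismatches, so `hm` makes `fourierConj_phase_ne_zero`
applicable. This is the exactness of the OR test: the test string is in superposition, yet never
gives the wrong verdict. -/
theorem rotAmplitude_support {m : ℕ} (hm : Fintype.card W < p ^ m) {Q : W → Query p W}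
    {y : Basis p (AuxWire p W m)} (hy : rotAmplitude m Q y ≠ 0) (w : W) :
    (∀ q, y (.inr (w, .inr q)) = 0) ∧
      ((fun j => y (.inr (w, .inl j))) = (0 : Fin m → ZMod p) ↔
        (Q w).mismatches (y ∘ Sum.inl) = 0) := by
  rw [rotAmplitude_eq, Finset.prod_ne_zero_iff] at hy
  constructor
  · intro q
    have h := hy (w, .inr q) (Finset.mem_univ _)
    by_contra h0
    exact h (by simp [rotTarget, h0])
  · have hk : (Q w).mismatches (y ∘ Sum.inl) < p ^ m := (Finset.card_le_univ _).trans_lt hm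
    refine fourierConj_phase_ne_zero hk fun j => ?_
    have h := hy (w, .inl j) (Finset.mem_univ _)
    simpa only [rotTarget, if_true, prod_rotPhase, Sum.elim_comp_inl] using h

theorem rotAmplitude_congr (y y' : Basis p (AuxWire p W m)) (h : ∀ q, y (.inr q) = y' (.inr q))
    (h' : ∀ w, ∀ s ∈ (Q w).conds, y (.inl s) = y' (.inl s)) :
    rotAmplitude m Q y = rotAmplitude m Q y' := by
  rw [rotAmplitude_eq, rotAmplitude_eq]
  refine Finset.prod_congr rfl fun q _ => ?_
  rw [h]
  rcases q with ⟨w, j | q⟩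
  · simp only [prod_rotPhase, Sum.elim_comp_inl]
    have : (Q w).mismatches (y ∘ Sum.inl) = (Q w).mismatches (y' ∘ Sum.inl) := by
      rw [Query.mismatches, Query.mismatches]
      congr 1
      refine Finset.filter_congr fun s hs => ?_
      rw [Function.comp, Function.comp, h' w s hs]
    rw [this]
  · rfl

/-- The stage preserves the input wires, and the auxiliary wires start at zero, so a single column
contributes to each entry. -/
theorem stage_rot_mulVec (ψ : Basis p W → ℂ) :
    (stage (V := AuxWire p W m) (rotTarget m) (rotPhase m Q)).mulVec
      (extendZero Function.Embedding.inl ψ) = fun y => ψ (y ∘ Sum.inl) * rotAmplitude m Q y := by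
  ext y
  rw [Matrix.mulVec, dotProduct, Finset.sum_eq_single (Sum.elim (y ∘ Sum.inl) 0)]
  · have hq : ∀ q : Aux p W m, Sum.elim (y ∘ Sum.inl) (0 : Aux p W m → ZMod p) (.inr q) = 0 :=
      fun q => rfl
    rw [extendZero_inl, if_pos hq, rotAmplitude, mul_comm]
    rfl
  · intro x _ hx
    by_cases h0 : ∀ q, x (.inr q) = 0
    · have : ∃ i, y (.inl i) ≠ x (.inl i) := by
        by_contra! h
        refine hx (funext ?_)
        rintro (i | q)
        · exact (h i).symm
        · exact h0 q
      obtain ⟨i, hi⟩ := this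
      rw [stage_apply _ _ (rotPhase_eq_one m Q),
        Finset.prod_eq_zero (Finset.mem_univ (Sum.inl i)), zero_mul]
      simp [rotTarget, hi]
    · rw [extendZero_inl, if_neg h0, mul_zero]
  · simp

/-- Only the rotation stage creates superpositions. The other two act as basis shifts on the states
that occur, so they merely move the arguments of `rotAmplitude`. -/
theorem load_mulVec {m : ℕ} (hm : Fintype.card W < p ^ m) (Q : W → Query p W)
    (ψ : Basis p W → ℂ) :
    (load m Q).mulVec (extendZero Function.Embedding.inl ψ) =
      fun y => ψ (y ∘ Sum.inl) * loadAmplitude m Q y := by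
  have h0 : ∀ y : Basis p (AuxWire p W m), (y - formShift m y) ∘ Sum.inl = y ∘ Sum.inl :=
    fun y => funext fun i => sub_zero _
  have h0' : ∀ y : Basis p (AuxWire p W m), (y - resShift m Q y) ∘ Sum.inl = y ∘ Sum.inl :=
    fun y => funext fun i => sub_zero _
  rw [load, ← Matrix.mulVec_mulVec, ← Matrix.mulVec_mulVec, stage_rot_mulVec,
    stage_mulVec_of_shift _ _ (formPhase_eq_one m) (formShift m),
    stage_mulVec_of_shift _ _ (resPhase_eq_one m Q) (resShift m Q)]
  · ext y
    simp only [h0, h0', loadAmplitude]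
  · rintro x (w | ⟨w, q | q | q⟩) h
    exacts [rfl, rfl, rfl, Bool.noConfusion h]
  · intro x y h
    have hxy : x ∘ Sum.inl = y ∘ Sum.inl := funext fun i => h (.inl i) rfl
    funext w
    rcases w with w | ⟨w, q | q | q⟩ <;> simp [resShift, hxy]
  -- The result stage is a shift only on reachable states. A nonzero rotation amplitude supplies
  -- both hypotheses of `prod_resPhase`: the form wires were `0` before their shift, and `z = 0`
  -- means no mismatch.
  · intro x hx
    simp only [h0] at hx
    have hx := right_ne_zero_of_mul hx
    rintro (w | ⟨w, q | q | u⟩) h b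
    · cases h
    · cases h
    · cases h
    · obtain ⟨h1, h2⟩ := rotAmplitude_support hm hx w
      refine prod_resPhase m Q x w u b (fun s => ?_) ?_
      · exact sub_eq_zero.1 (h1 (.inl s))
      · rw [h0] at h2
        rw [← h2]
        have : ∀ j, (x - formShift m x) (.inr (w, .inl j)) = x (.inr (w, .inl j)) :=
          fun j => sub_zero _
        simp only [this]
  · rintro x (w | ⟨w, q | q | q⟩) h
    exacts [rfl, rfl, Bool.noConfusion h, rfl]
  · intro x y h
    funext w
    rcases w with w | ⟨w, q | q | q⟩
    · rfl
    · rfl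
    · simp only [formShift, h (.inr (w, .inl _)) rfl]
    · rfl
  · rintro x - (w | ⟨w, q | q | q⟩) h b
    · cases h
    · cases h
    · rw [prod_formPhase]; rfl
    · cases h

theorem loadAmplitude_support {m : ℕ} (hm : Fintype.card W < p ^ m) {Q : W → Query p W}
    {y : Basis p (AuxWire p W m)} (hy : loadAmplitude m Q y ≠ 0) (w : W) :
    y (.inr (w, .inr (.inr ()))) = (Q w).value (y ∘ Sum.inl) := by
  have h := (rotAmplitude_support hm hy w).1 (.inr ())
  -- `formShift` vanishes at the answer wire, so only the result shift has to be undone there.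
  exact sub_eq_zero.1 ((sub_zero _).symm.trans h)

/-- The garbage depends on the input only through wires that some query reads; hence gates may
modify all other wires without disturbing the uncomputation. -/
theorem loadAmplitude_congr (y y' : Basis p (AuxWire p W m)) (h : ∀ q, y (.inr q) = y' (.inr q))
    (hc : ∀ w, ∀ s ∈ (Q w).conds, y (.inl s) = y' (.inl s))
    (hs : ∀ w, ∀ s ∈ (Q w).srcs, y (.inl s) = y' (.inl s)) :
    loadAmplitude m Q y = loadAmplitude m Q y' := by
  have hv : ∀ w, (Q w).value (y ∘ Sum.inl) = (Q w).value (y' ∘ Sum.inl) := by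
    intro w
    have : (Q w).mismatches (y ∘ Sum.inl) = (Q w).mismatches (y' ∘ Sum.inl) := by
      rw [Query.mismatches, Query.mismatches]
      congr 1
      refine Finset.filter_congr fun s h => ?_
      rw [Function.comp, Function.comp, hc w s h]
    rw [Query.value, Query.value, this]
    congr 1
    exact Finset.sum_congr rfl fun s h => hs w s h
  refine rotAmplitude_congr m Q _ _ ?_ ?_
  · rintro ⟨w, q | q | q⟩
    · simp [resShift, formShift, h]
    · simp [resShift, formShift, h]
    · simp [resShift, formShift, h, hv]
  · intro w s hs
    simp [resShift, formShift, hc w s hs]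

end Loading

end Qudit

namespace Qudit

/-! ### Simulating layers by loading, acting and unloading -/

section LayerSimulation

variable {p : ℕ} [Fact p.Prime] {W : Type} [Fintype W] [DecidableEq W]

/-- The information about the wires outside its targets on which a gate depends. -/
def Gate.query : Gate p W → Query p W
  | .ctrl S v _ _ _ => ⟨S, v, ∅⟩
  | .qmod _ _ _ => ⟨∅, 0, ∅⟩
  | .cfanout c _ _ => ⟨∅, 0, {c}⟩

theorem Gate.targets_subset (g : Gate p W) : g.targets ⊆ g.support := by
  cases g <;> simp [Gate.targets, Gate.support]

theorem Gate.query_subset (g : Gate p W) :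
    g.query.conds ⊆ g.support ∧ g.query.srcs ⊆ g.support := by
  cases g <;> simp [Gate.query, Gate.support]

theorem Gate.notMem_query (g : Gate p W) {t : W} (ht : t ∈ g.targets) :
    t ∉ g.query.conds ∧ t ∉ g.query.srcs := by
  cases g with
  | ctrl S v u hu U =>
    rw [Gate.targets, Finset.mem_singleton] at ht
    subst ht
    simpa [Gate.query] using hu
  | qmod S u hu => simp [Gate.query]
  | cfanout c T hc =>
    have : t ≠ c := fun h => hc (h ▸ ht)
    simpa [Gate.query] using this

/-- Supports in a layer are disjoint, so a wire is a target of at most one gate, whose query it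
inherits. A gate does not query its own targets, and the other gates do not touch them. -/
theorem exists_queries {L : List (Gate p W)}
    (hL : L.Pairwise fun g h => Disjoint g.support h.support) :
    ∃ Q : W → Query p W, (∀ g ∈ L, ∀ t ∈ g.targets, Q t = g.query) ∧
      ∀ g ∈ L, ∀ t ∈ g.targets, ∀ w, t ∉ (Q w).conds ∧ t ∉ (Q w).srcs := by
  classical
  have : Std.Symm fun g h : Gate p W => Disjoint g.support h.support := ⟨fun _ _ h => h.symm⟩
  have hdisj : ∀ g ∈ L, ∀ h ∈ L, ∀ w, w ∈ g.support → w ∈ h.support → g = h := by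
    intro g hg h hh w hwg hwh
    by_contra hne
    exact Finset.disjoint_left.1
      (List.Pairwise.forall hL hg hh hne) hwg hwh
  -- Wires that are targets of no gate ask the empty query.
  let Q : W → Query p W := fun w =>
    if h : ∃ g ∈ L, w ∈ g.targets then h.choose.query else ⟨∅, 0, ∅⟩
  have hQ : ∀ g ∈ L, ∀ t ∈ g.targets, Q t = g.query := by
    intro g hg t ht
    have h : ∃ g ∈ L, t ∈ g.targets := ⟨g, hg, ht⟩
    simp only [Q, dif_pos h]
    rw [hdisj _ h.choose_spec.1 g hg t (Gate.targets_subset _ h.choose_spec.2)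
      (g.targets_subset ht)]
  refine ⟨Q, hQ, fun g hg t ht w => ?_⟩
  by_cases h : ∃ h ∈ L, w ∈ h.targets
  · obtain ⟨h, hh, hw⟩ := h
    rw [hQ h hh w hw]
    by_cases hgh : g = h
    · subst hgh
      exact g.notMem_query ht
    · exact ⟨fun hc => hgh (hdisj g hg h hh t (g.targets_subset ht) (h.query_subset.1 hc)),
        fun hc => hgh (hdisj g hg h hh t (g.targets_subset ht) (h.query_subset.2 hc))⟩
  · simp [Q, dif_neg h]

/-- The auxiliary wire that holds the answer to the query of `w`. -/
def answerWire (p m : ℕ) (w : W) : Aux p W m := (w, .inr (.inr ()))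

theorem answerWire_injective (m : ℕ) : Function.Injective (answerWire p m : W → Aux p W m) :=
  fun _ _ h => congrArg Prod.fst h

theorem loaded_loadAmplitude {m : ℕ} (hm : Fintype.card W < p ^ m) {Q : W → Query p W}
    {g : Gate p W} (hQ : ∀ t ∈ g.targets, Q t = g.query)
    (hg : ∀ t ∈ g.targets, ∀ w, t ∉ (Q w).conds ∧ t ∉ (Q w).srcs) :
    g.Loaded (answerWire p m) (loadAmplitude m Q) := by
  refine ⟨fun y y' h h' => loadAmplitude_congr m Q y y' h
    (fun w s hs => h' s fun hst => (hg s hst w).1 hs)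
    fun w s hs => h' s fun hst => (hg s hst w).2 hs, ?_⟩
  cases g with
  | ctrl S v t ht U =>
    intro y hy
    have hp : (1 : ZMod p) ≠ 0 := one_ne_zero
    rw [answerWire, loadAmplitude_support hm hy, hQ t (Finset.mem_singleton_self t), Query.value,
      Query.mismatches, Gate.query]
    simp only [Finset.sum_empty, add_zero, ite_eq_left_iff, hp, imp_false, not_not,
      Finset.card_eq_zero, Finset.filter_eq_empty_iff, Function.comp]
  | qmod S t ht => trivial
  | cfanout c T hc =>
    intro y hy t ht
    rw [answerWire, loadAmplitude_support hm hy, hQ t ht, Query.value, Query.mismatches, Gate.query]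
    simp

/-- The wires of the simulation. -/
abbrev SimWire (p : ℕ) (W : Type) (m : ℕ) : Type := AuxWire p W m ⊕ PairWires (AuxWire p W m)

def simEmb (p : ℕ) (W : Type) (m : ℕ) : W ↪ SimWire p W m :=
  Function.Embedding.inl.trans Function.Embedding.inl

/-- Acting on the loaded state of `ψ` gives the loaded state of the transformed `ψ`, so unloading
leaves clean ancillas. The depth is `3 * (p + 8)` for loading and again for unloading, plus one
layer of localized gates. -/
theorem implementable_layer {m : ℕ} (hm : Fintype.card W < p ^ m) {L : List (Gate p W)}
    (hL : L.Pairwise fun g h => Disjoint g.support h.support) :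
    Implementable (simEmb p W m) (6 * p + 49) (ops L) := by
  obtain ⟨Q, hQ, hg⟩ := exists_queries hL
  have h1 : Implementable (X := SimWire p W m) Function.Embedding.inl (3 * (p + 8)) (load m Q) :=
    (((Implementable.stage _ _).mul (.stage _ _)).mul (.stage _ _)).mono (by omega)
  have h2 : Implementable (X := SimWire p W m) Function.Embedding.inl (3 * (p + 8))
      (unload m Q) :=
    (((Implementable.stage _ _).mul (.stage _ _)).mul (.stage _ _)).mono (by omega)
  have h3 : Implementable (X := SimWire p W m) Function.Embedding.inl 1
      (ops (L.flatMap (Gate.localize (answerWire p m)))) := by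
    refine .layer _ (localize_layer_pairwise (answerWire_injective m) hL) fun g hg => ?_
    obtain ⟨g', -, hg'⟩ := List.mem_flatMap.1 hg
    exact Gate.localize_mem _ g' g hg'
  refine Implementable.restrict ((h2.mul (h3.mul h1)).mono (by omega)) fun ψ => ?_
  rw [← Matrix.mulVec_mulVec, ← Matrix.mulVec_mulVec, load_mulVec hm, localize_layer_mulVec
    fun g hgL => loaded_loadAmplitude hm (hQ g hgL) (hg g hgL), ← load_mulVec hm,
    Matrix.mulVec_mulVec, unload_mul_load, Matrix.one_mulVec]

theorem implementable_layers {m : ℕ} (hm : Fintype.card W < p ^ m) (Ls : List (List (Gate p W)))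
    (hL : ∀ L ∈ Ls, L.Pairwise fun g h => Disjoint g.support h.support) :
    Implementable (simEmb p W m) (Ls.length * (6 * p + 49)) (ops Ls.flatten) := by
  induction Ls with
  | nil => exact (Implementable.one _).mono (Nat.zero_le _)
  | cons L Ls ih =>
    rw [List.flatten_cons, ops_append]
    refine ((ih fun L hL' => hL L (List.mem_cons_of_mem _ hL')).mul
      (implementable_layer hm (hL L (List.mem_cons_self ..)))).mono ?_
    rw [List.length_cons, add_mul]
    omega

end LayerSimulation

end Qudit

namespace Qudit

/-! ### Density matrices with added zeros, and partial traces -/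

section Density

variable {d : ℕ} [NeZero d] {U V W : Type} [Fintype U] [DecidableEq U] [Fintype V] [DecidableEq V]
  [Fintype W] [DecidableEq W]

/-- The isometry that adds qudits in state `|0⟩` on the wires outside the range of `f`. -/
noncomputable def zeroIsometry (f : V ↪ W) : Matrix (Basis d W) (Basis d V) ℂ :=
  open Classical in Matrix.of fun Y x => if (∀ w, w ∉ Set.range f → Y w = 0) ∧ Y ∘ f = x then 1 else 0

theorem zeroIsometry_mulVec (f : V ↪ W) (ψ : Basis d V → ℂ) :
    (zeroIsometry f).mulVec ψ = extendZero f ψ := by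
  ext Y
  rw [Matrix.mulVec, dotProduct, Finset.sum_eq_single (Y ∘ f)]
  · simp [zeroIsometry, extendZero]
  · intro x _ hx
    simp [zeroIsometry, Ne.symm hx]
  · simp

/-- The density matrix that is `σ` on the wires in the range of `f` and `|0⟩⟨0|` on the others. -/
noncomputable def extendDensity (f : V ↪ W) (σ : Operator d V) : Operator d W :=
  zeroIsometry (d := d) f * σ * (zeroIsometry (d := d) f).conjTranspose

theorem extendDensity_apply (f : V ↪ W) (σ : Operator d V) (Y X : Basis d W) :
    extendDensity f σ Y X =
      open Classical in if (∀ w, w ∉ Set.range f → Y w = 0) ∧ (∀ w, w ∉ Set.range f → X w = 0) then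
        σ (Y ∘ f) (X ∘ f) else 0 := by
  rw [extendDensity, Matrix.mul_apply, Finset.sum_eq_single (X ∘ f), Matrix.mul_apply,
    Finset.sum_eq_single (Y ∘ f)]
  · have hE : ∀ Z : Basis d W, zeroIsometry f Z (Z ∘ f) =
        open Classical in if ∀ w, w ∉ Set.range f → Z w = 0 then (1 : ℂ) else 0 := fun Z => by
      simp [zeroIsometry]
    rw [Matrix.conjTranspose_apply, hE, hE]
    by_cases hY : ∀ w, w ∉ Set.range f → Y w = 0 <;>
      by_cases hX : ∀ w, w ∉ Set.range f → X w = 0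
    · rw [if_pos hY, if_pos hX, if_pos ⟨hY, hX⟩, star_one, one_mul, mul_one]
    · rw [if_neg hX, if_neg fun h : _ ∧ _ => hX h.2, star_zero, mul_zero]
    · rw [if_neg hY, if_neg fun h : (∀ w, w ∉ Set.range f → Y w = 0) ∧ _ => hY h.1, zero_mul,
        zero_mul]
    · rw [if_neg hY, if_neg fun h : (∀ w, w ∉ Set.range f → Y w = 0) ∧ _ => hY h.1, zero_mul,
        zero_mul]
  · intro x _ hx
    simp [zeroIsometry, Ne.symm hx]
  · simp
  · intro x _ hx
    simp [zeroIsometry, Ne.symm hx]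
  · simp

theorem withAncillasDensity_eq {n a : ℕ} (ρ : Operator d (Fin n)) :
    withAncillasDensity a ρ = extendDensity Function.Embedding.inl ρ := by
  ext Y X
  rw [extendDensity_apply]
  simp [withAncillasDensity, Function.comp_def]

theorem zeroIsometry_trans (f : U ↪ V) (g : V ↪ W) :
    zeroIsometry (d := d) g * zeroIsometry (d := d) f = zeroIsometry (d := d) (f.trans g) := by
  refine Matrix.ext_of_mulVec_single fun x => ?_
  rw [← Matrix.mulVec_mulVec, zeroIsometry_mulVec, zeroIsometry_mulVec, zeroIsometry_mulVec,
    extendZero_trans]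

theorem extendDensity_trans (f : U ↪ V) (g : V ↪ W) (σ : Operator d U) :
    extendDensity g (extendDensity f σ) = extendDensity (f.trans g) σ := by
  simp only [extendDensity, ← zeroIsometry_trans, Matrix.conjTranspose_mul, Matrix.mul_assoc]

/-- The hypothesis says that `M` and `N` are intertwined by the isometry `zeroIsometry f`; this
carries vector identities over to density matrices. -/
theorem conj_extendDensity {f : V ↪ W} {M : Operator d W} {N : Operator d V}
    (h : ∀ ψ, M.mulVec (extendZero f ψ) = extendZero f (N.mulVec ψ)) (σ : Operator d V) :
    M * extendDensity f σ * M.conjTranspose = extendDensity f (N * σ * N.conjTranspose) := by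
  have hM : M * zeroIsometry (d := d) f = zeroIsometry (d := d) f * N := by
    refine Matrix.ext_of_mulVec_single fun x => ?_
    rw [← Matrix.mulVec_mulVec, ← Matrix.mulVec_mulVec, zeroIsometry_mulVec, zeroIsometry_mulVec, h]
  calc M * extendDensity f σ * M.conjTranspose =
      M * zeroIsometry (d := d) f * σ * (M * zeroIsometry (d := d) f).conjTranspose := by
        simp only [extendDensity, Matrix.conjTranspose_mul, Matrix.mul_assoc]
    _ = extendDensity f (N * σ * N.conjTranspose) := by
        rw [hM]
        simp only [extendDensity, Matrix.conjTranspose_mul, Matrix.mul_assoc]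

/-- The partial trace that keeps the wires in the range of `f`. -/
noncomputable def partialTrace (f : V ↪ W) (σ : Operator d W) : Operator d V :=
  open Classical in Matrix.of fun y x => ∑ P : Basis d W × Basis d W,
    if P.1 ∘ f = y ∧ P.2 ∘ f = x ∧ ∀ w, w ∉ Set.range f → P.1 w = P.2 w then σ P.1 P.2 else 0

theorem readOut_eq {l : ℕ} (out : Fin l ↪ W) (σ : Operator d W) :
    readOut out σ = partialTrace out σ := by
  ext y x
  simp only [readOut, partialTrace, Matrix.of_apply, Fintype.sum_prod_type, funext_iff,
    Function.comp]

theorem partialTrace_trans (f : U ↪ V) (g : V ↪ W) (σ : Operator d W) :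
    partialTrace f (partialTrace g σ) = partialTrace (f.trans g) σ := by
  classical
  ext y x
  simp only [partialTrace, Matrix.of_apply]
  have h : ∀ P' : Basis d V × Basis d V,
      (if P'.1 ∘ f = y ∧ P'.2 ∘ f = x ∧ (∀ w, w ∉ Set.range f → P'.1 w = P'.2 w) then
        ∑ P : Basis d W × Basis d W, if P.1 ∘ g = P'.1 ∧ P.2 ∘ g = P'.2 ∧
          (∀ w, w ∉ Set.range g → P.1 w = P.2 w) then σ P.1 P.2 else 0 else 0) =
      ∑ P : Basis d W × Basis d W, if (P'.1 ∘ f = y ∧ P'.2 ∘ f = x ∧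
        (∀ w, w ∉ Set.range f → P'.1 w = P'.2 w)) ∧ P.1 ∘ g = P'.1 ∧ P.2 ∘ g = P'.2 ∧
          (∀ w, w ∉ Set.range g → P.1 w = P.2 w) then σ P.1 P.2 else 0 := by
    intro P'
    by_cases h : P'.1 ∘ f = y ∧ P'.2 ∘ f = x ∧ (∀ w, w ∉ Set.range f → P'.1 w = P'.2 w)
    · rw [if_pos h]
      exact Finset.sum_congr rfl fun P _ => if_congr (by rw [and_iff_right h]) rfl rfl
    · rw [if_neg h]
      exact (Finset.sum_eq_zero fun P _ => if_neg fun h' => h h'.1).symm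
  simp only [h]
  rw [Finset.sum_comm]
  refine Finset.sum_congr rfl fun P _ => ?_
  rw [Finset.sum_eq_single (P.1 ∘ g, P.2 ∘ g)]
  · refine if_congr ⟨?_, ?_⟩ rfl rfl
    · rintro ⟨⟨h1, h2, h3⟩, -, -, h4⟩
      refine ⟨h1, h2, fun w hw => ?_⟩
      by_cases hg : w ∈ Set.range g
      · obtain ⟨v, rfl⟩ := hg
        exact h3 v fun ⟨u, hu⟩ => hw ⟨u, congrArg g hu⟩
      · exact h4 w hg
    · rintro ⟨h1, h2, h3⟩
      refine ⟨⟨h1, h2, fun w hw => h3 _ ?_⟩, rfl, rfl, fun w hw => h3 _ ?_⟩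
      · rintro ⟨u, hu⟩
        exact hw ⟨u, g.injective hu⟩
      · rintro ⟨u, rfl⟩
        exact hw ⟨f u, rfl⟩
  · intro P' _ hP'
    refine if_neg fun h => hP' (Prod.ext h.2.1.symm h.2.2.1.symm)
  · simp

theorem partialTrace_extendDensity (f : V ↪ W) (σ : Operator d V) :
    partialTrace f (extendDensity f σ) = σ := by
  classical
  ext y x
  have h0 : ∀ (z : Basis d V) w, w ∉ Set.range f → Function.extend f z (0 : Basis d W) w = 0 :=
    fun z w hw => by rw [Function.extend_apply' _ _ _ hw]; rfl
  have hc : ∀ z : Basis d V, Function.extend f z (0 : Basis d W) ∘ f = z := fun z => by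
    ext v; simp [f.injective.extend_apply]
  simp only [partialTrace, Matrix.of_apply, extendDensity_apply]
  rw [Finset.sum_eq_single (Function.extend f y 0, Function.extend f x 0)]
  · rw [if_pos ⟨hc y, hc x, fun w hw => (h0 y w hw).trans (h0 x w hw).symm⟩, if_pos ⟨h0 y, h0 x⟩, hc, hc]
  · rintro ⟨Y, X⟩ _ hP
    by_contra hne
    simp only [ite_eq_right_iff, not_forall] at hne
    obtain ⟨⟨rfl, rfl, -⟩, ⟨h1, h2⟩, -⟩ := hne
    have he : ∀ Z : Basis d W, (∀ w, w ∉ Set.range f → Z w = 0) →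
        Z = Function.extend f (Z ∘ f) 0 := by
      intro Z hZ
      ext w
      by_cases hw : ∃ v, f v = w
      · obtain ⟨v, rfl⟩ := hw
        simp [f.injective.extend_apply]
      · rw [hZ w hw, h0 _ w hw]
    exact hP (Prod.ext (he Y h1) (he X h2))
  · simp

theorem partialTrace_inl (σ : Operator d (V ⊕ W)) (y x : Basis d V) :
    partialTrace Function.Embedding.inl σ y x = ∑ r : Basis d W, σ (Sum.elim y r) (Sum.elim x r) := by
  classical
  simp only [partialTrace, Matrix.of_apply]
  rw [← Finset.sum_filter]
  refine (Finset.sum_nbij' (fun r => (Sum.elim y r, Sum.elim x r)) (fun P => P.1 ∘ Sum.inr)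
    ?_ ?_ ?_ ?_ ?_).symm
  · intro r _
    simp [Function.comp_def]
  · simp
  · simp
  · rintro ⟨Y, X⟩ hP
    simp only [Finset.mem_filter, Finset.mem_univ, true_and] at hP
    obtain ⟨h1, h2, h3⟩ := hP
    refine Prod.ext (funext ?_) (funext ?_)
    · rintro (v | w)
      · exact (congrFun h1 v).symm
      · rfl
    · rintro (v | w)
      · exact (congrFun h2 v).symm
      · exact h3 _ (by simp)
  · simp

end Density

/-! ### Deferred measurement -/

section Deferred

variable {d : ℕ} [NeZero d] {W R : Type} [Fintype W] [DecidableEq W] [Fintype R] [DecidableEq R]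

theorem conj_apply_of_mulVec {V : Type} [Fintype V] [DecidableEq V] {G : Operator d V}
    {u : Basis d V → Basis d V} (hG : ∀ φ, G.mulVec φ = φ ∘ u) (σ : Operator d V)
    (Y X : Basis d V) : (G * σ * G.conjTranspose) Y X = σ (u Y) (u X) := by
  have h : ∀ (τ : Operator d V) Y X, (G * τ) Y X = τ (u Y) X := fun τ Y X =>
    congrFun (hG fun Z => τ Z X) Y
  have h2 : (G * σ * G.conjTranspose) Y X =
      star ((G * (G * σ).conjTranspose) X Y) := by
    rw [← Matrix.conjTranspose_apply, Matrix.conjTranspose_mul, Matrix.conjTranspose_conjTranspose]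
  rw [h2, h, Matrix.conjTranspose_apply, star_star, h]

theorem cfanout_conj_apply {V : Type} [Fintype V] [DecidableEq V] (c : V) (T : Finset V)
    (hc : c ∉ T) (σ : Operator d V) (Y X : Basis d V) :
    ((Gate.cfanout c T hc).op * σ * (Gate.cfanout c T hc).op.conjTranspose : Operator d V) Y X =
      σ (fun w => if w ∈ T then Y w - Y c else Y w) (fun w => if w ∈ T then X w - X c else X w) :=
  conj_apply_of_mulVec (u := fun y w => if w ∈ T then y w - y c else y w)
    (fun φ => cfanout_mulVec c T hc φ) σ Y X

/-- The block of an operator for given basis states of the wires `R`. -/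
def block (r r' : Basis d R) (σ : Operator d (W ⊕ R)) : Operator d W :=
  Matrix.of fun y x => σ (Sum.elim y r) (Sum.elim x r')

/-- A gate on `W` leaves the basis states of `R` alone, so it acts block by block; the partial trace
over `R` sums the diagonal blocks. -/
theorem block_conj_map_inl (g : Gate d W) (σ : Operator d (W ⊕ R)) (r r' : Basis d R) :
    block r r' ((g.map Function.Embedding.inl).op * σ *
        (g.map Function.Embedding.inl).op.conjTranspose) =
      g.op * block r r' σ * g.op.conjTranspose := by
  set G : Operator d (W ⊕ R) := (g.map Function.Embedding.inl).op
  have h : ∀ (τ : Operator d (W ⊕ R)) y r X,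
      (G * τ) (Sum.elim y r) X = ∑ x, g.op y x * τ (Sum.elim x r) X := by
    intro τ y r X
    have h1 : ∀ x : Basis d W, Function.extend (Function.Embedding.inl : W ↪ W ⊕ R) x
        (Sum.elim y r) = Sum.elim x r := by
      intro x
      ext (w | q)
      · exact (Function.Embedding.inl : W ↪ W ⊕ R).injective.extend_apply x _ w
      · exact Function.extend_apply' _ _ _ (by simp)
    have h2 := Gate.map_mulVec (Function.Embedding.inl : W ↪ W ⊕ R) g (fun Z => τ Z X)
      (Sum.elim y r) (Sum.elim y r) fun _ _ => rfl
    simp only [h1] at h2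
    exact h2
  ext y x
  have h2 : (G * σ * G.conjTranspose) (Sum.elim y r) (Sum.elim x r') =
      star ((G * (G * σ).conjTranspose) (Sum.elim x r') (Sum.elim y r)) := by
    rw [← Matrix.conjTranspose_apply, Matrix.conjTranspose_mul, Matrix.conjTranspose_conjTranspose]
  rw [block, Matrix.of_apply, h2, h, Matrix.mul_apply, star_sum]
  refine Finset.sum_congr rfl fun z _ => ?_
  rw [star_mul', Matrix.conjTranspose_apply, star_star, h, Matrix.mul_apply,
    Matrix.conjTranspose_apply, mul_comm]
  rfl

/-- The coherent version of a gate: the outcome of a measurement is added to the wire `q`. -/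
noncomputable def Gate.coherent (q : R) : Gate d W → Gate d (W ⊕ R)
  | .cfanout c T hc => .cfanout (.inl c) (insert (.inr q) (T.map Function.Embedding.inl))
      (by simpa using hc)
  | g => g.map Function.Embedding.inl

theorem Gate.coherent_support (q : R) (g : Gate d W) :
    (g.coherent q).support ⊆ insert (.inr q) (g.support.map Function.Embedding.inl) := by
  cases g with
  | cfanout c T hc =>
    simp [Gate.coherent, Gate.support, Finset.map_insert, Finset.insert_comm]
  | ctrl S v t ht U =>
    exact (Gate.support_map _ (Gate.ctrl S v t ht U)).trans_subset (Finset.subset_insert _ _)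
  | qmod S t ht =>
    exact (Gate.support_map _ (Gate.qmod (d := d) S t ht)).trans_subset (Finset.subset_insert _ _)

/-- A fresh wire that received the value of `c` and is then discarded reveals this value to the
environment: entries with different values of `c` cannot agree on `q` and are lost, which is
`dephase`. -/
theorem Gate.coherent_conj (q : R) (g : Gate d W) (σ : Operator d (W ⊕ R))
    (hσ : ∀ Y X, σ Y X ≠ 0 → Y (.inr q) = 0 ∧ X (.inr q) = 0) :
    partialTrace Function.Embedding.inl ((g.coherent q).op * σ * (g.coherent q).op.conjTranspose) =
      g.channel (partialTrace Function.Embedding.inl σ) := by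
  have hmap : ∀ g : Gate d W, partialTrace Function.Embedding.inl
      ((g.map Function.Embedding.inl).op * σ * (g.map Function.Embedding.inl).op.conjTranspose) =
      g.op * partialTrace Function.Embedding.inl σ * g.op.conjTranspose := by
    intro g
    have h : ∀ τ : Operator d (W ⊕ R),
        partialTrace Function.Embedding.inl τ = ∑ r : Basis d R, block r r τ := by
      intro τ
      ext y x
      rw [partialTrace_inl, Matrix.sum_apply]
      rfl
    rw [h, h, Matrix.mul_sum, Matrix.sum_mul]
    exact Finset.sum_congr rfl fun r _ => block_conj_map_inl g σ r r
  cases g with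
  | ctrl S v t ht U => exact hmap (.ctrl S v t ht U)
  | qmod S t ht => exact hmap (.qmod S t ht)
  | cfanout c T hc =>
    ext y x
    rw [Gate.channel, cfanout_conj_apply, partialTrace_inl]
    simp only [Gate.coherent, cfanout_conj_apply]
    let u : Basis d W → Basis d W := fun y w => if w ∈ T then y w - y c else y w
    have hu : ∀ (y : Basis d W) (r : Basis d R), (fun w =>
        if w ∈ insert (.inr q) (T.map (Function.Embedding.inl : W ↪ W ⊕ R)) then
          (Sum.elim y r : Basis d (W ⊕ R)) w - (Sum.elim y r : Basis d (W ⊕ R)) (.inl c)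
        else (Sum.elim y r : Basis d (W ⊕ R)) w) =
        Sum.elim (u y) (Function.update r q (r q - y c)) := by
      intro y r
      ext (w | w)
      · simp [u]
      · by_cases hw : w = q
        · subst hw; simp
        · simp [hw]
    have huc : ∀ y : Basis d W, u y c = y c := fun y => if_neg hc
    simp only [hu]
    change _ = dephase c _ (u y) (u x)
    rw [dephase, Matrix.of_apply, huc, huc]
    by_cases hyx : y c = x c
    · rw [if_pos hyx, partialTrace_inl, hyx]
      -- For equal values of `c` both indices shift the label by the same amount, which only
      -- permutes the sum.
      let e : Basis d R ≃ Basis d R :=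
        { toFun := fun r => Function.update r q (r q - x c)
          invFun := fun r => Function.update r q (r q + x c)
          left_inv := fun r => by simp
          right_inv := fun r => by simp }
      exact Equiv.sum_comp e fun r => σ (Sum.elim (u y) r) (Sum.elim (u x) r)
    · rw [if_neg hyx]
      refine Finset.sum_eq_zero fun r _ => ?_
      by_contra hne
      obtain ⟨h1, h2⟩ := hσ _ _ hne
      simp only [Sum.elim_inr, Function.update_self, sub_eq_zero] at h1 h2
      exact hyx (h1.symm.trans h2)

/-- The labels of later gates remain fresh, as the induction in `deferred_measurement` requires. -/
theorem Gate.coherent_conj_eq_zero (q q' : R) (hq : q' ≠ q) (g : Gate d W) (σ : Operator d (W ⊕ R))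
    (hσ : ∀ Y X, σ Y X ≠ 0 → Y (.inr q') = 0 ∧ X (.inr q') = 0) (Y X : Basis d (W ⊕ R))
    (h : ((g.coherent q).op * σ * (g.coherent q).op.conjTranspose) Y X ≠ 0) :
    Y (.inr q') = 0 ∧ X (.inr q') = 0 := by
  have hmap : ∀ g : Gate d W, ((g.map Function.Embedding.inl).op * σ *
      (g.map Function.Embedding.inl).op.conjTranspose : Operator d (W ⊕ R)) Y X ≠ 0 →
      Y (.inr q') = 0 ∧ X (.inr q') = 0 := by
    intro g h
    by_contra hne
    have hb : block (Y ∘ Sum.inr) (X ∘ Sum.inr) σ = 0 := by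
      ext y x
      by_contra h0
      exact hne (hσ (Sum.elim y _) (Sum.elim x _) h0)
    have h1 := block_conj_map_inl g σ (Y ∘ Sum.inr) (X ∘ Sum.inr)
    rw [hb, Matrix.mul_zero, Matrix.zero_mul] at h1
    have h2 := congrFun (congrFun h1 (Y ∘ Sum.inl)) (X ∘ Sum.inl)
    rw [block, Matrix.of_apply, Sum.elim_comp_inl_inr, Sum.elim_comp_inl_inr] at h2
    exact h h2
  cases g with
  | ctrl S v t ht U => exact hmap (.ctrl S v t ht U) h
  | qmod S t ht => exact hmap (.qmod S t ht) h
  | cfanout c T hc =>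
    simp only [Gate.coherent, cfanout_conj_apply] at h
    simpa [hq] using hσ _ _ h

theorem deferred_measurement (l : List (Gate d W × R)) (hl : (l.map Prod.snd).Nodup)
    (σ : Operator d (W ⊕ R))
    (hσ : ∀ q ∈ l.map Prod.snd, ∀ Y X, σ Y X ≠ 0 → Y (.inr q) = 0 ∧ X (.inr q) = 0) :
    partialTrace Function.Embedding.inl (ops (l.map fun a => a.1.coherent a.2) * σ *
        (ops (l.map fun a => a.1.coherent a.2)).conjTranspose) =
      (l.map Prod.fst).foldl (fun τ g => g.channel τ) (partialTrace Function.Embedding.inl σ) := by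
  induction l generalizing σ with
  | nil => simp
  | cons a l ih =>
    rw [List.map_cons, List.nodup_cons] at hl
    have h := ih hl.2 ((a.1.coherent a.2).op * σ * (a.1.coherent a.2).op.conjTranspose)
      fun q hq => Gate.coherent_conj_eq_zero a.2 q (ne_of_mem_of_not_mem hq hl.1) a.1 σ
        (hσ q (List.mem_cons_of_mem _ hq))
    rw [Gate.coherent_conj a.2 a.1 σ (hσ a.2 (List.mem_cons_self ..))] at h
    rw [List.map_cons, List.map_cons, List.foldl_cons, ← h]
    simp only [ops_cons, Matrix.conjTranspose_mul, Matrix.mul_assoc]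

/-- Private labels keep the coherent gates of a layer disjoint and ensure that each label is written
at most once. -/
theorem exists_labels {α : Type} (Ls : List (List α)) :
    ∃ (R : Type) (_ : Fintype R) (_ : DecidableEq R) (Ls' : List (List (α × R))),
      Fintype.card R = Ls.flatten.length ∧ Ls'.map (List.map Prod.fst) = Ls ∧
        (Ls'.flatten.map Prod.snd).Nodup := by
  induction Ls with
  | nil => exact ⟨Empty, inferInstance, inferInstance, [], by simp⟩
  | cons L Ls ih =>
    obtain ⟨R, _, _, Ls', h1, h2, h3⟩ := ih
    refine ⟨Fin L.length ⊕ R, inferInstance, inferInstance,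
      (List.finRange L.length).map (fun i => (L.get i, Sum.inl i)) ::
        Ls'.map (List.map (Prod.map id Sum.inr)), ?_, ?_, ?_⟩
    · simp [h1]
    · rw [List.map_cons, List.map_map, List.map_map]
      congr 1
      · exact List.map_get_finRange L
      · conv_rhs => rw [← h2]
        refine List.map_congr_left fun L' _ => ?_
        simp [Function.comp_def]
    · rw [List.flatten_cons, List.map_append, ← List.map_flatten, List.map_map, List.map_map]
      have e1 : (Prod.snd ∘ fun i : Fin L.length => (L.get i, (Sum.inl i : Fin L.length ⊕ R))) =
        Sum.inl := rfl
      have e2 : (Prod.snd ∘ Prod.map (id : α → α) (Sum.inr : R → Fin L.length ⊕ R)) =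
        Sum.inr ∘ Prod.snd := rfl
      rw [e1, e2, ← List.map_map]
      refine List.Nodup.append ((List.nodup_finRange _).map Sum.inl_injective)
        (h3.map Sum.inr_injective) ?_
      intro a ha hb
      obtain ⟨i, -, rfl⟩ := List.mem_map.1 ha
      obtain ⟨j, -, hj⟩ := List.mem_map.1 hb
      cases hj

end Deferred

end Qudit

namespace Qudit

/-! ### Polynomial bounds -/

section PolynomialBounds

/-- Domination by a power of `n + 2`. -/
def PolyBounded (f : ℕ → ℕ) : Prop := ∃ k, ∀ n, f n ≤ (n + 2) ^ k

theorem PolyBounded.const (K : ℕ) : PolyBounded fun _ => K :=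
  ⟨K, fun n => (Nat.lt_two_pow_self).le.trans (Nat.pow_le_pow_left (by omega) K)⟩

theorem PolyBounded.id : PolyBounded fun n => n := ⟨1, fun n => by
  rw [pow_one]; exact Nat.le_add_right n 2⟩

theorem PolyBounded.add {f g : ℕ → ℕ} (hf : PolyBounded f) (hg : PolyBounded g) :
    PolyBounded fun n => f n + g n := by
  obtain ⟨k, hk⟩ := hf
  obtain ⟨l, hl⟩ := hg
  refine ⟨k + l + 1, fun n => ?_⟩
  have h1 : (n + 2) ^ k ≤ (n + 2) ^ (k + l) := Nat.pow_le_pow_right (by omega) (by omega)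
  have h2 : (n + 2) ^ l ≤ (n + 2) ^ (k + l) := Nat.pow_le_pow_right (by omega) (by omega)
  calc f n + g n ≤ (n + 2) ^ (k + l) * 2 := by linarith [hk n, hl n]
    _ ≤ (n + 2) ^ (k + l + 1) := by
      rw [pow_succ]
      exact Nat.mul_le_mul_left _ (by omega)

theorem PolyBounded.mul {f g : ℕ → ℕ} (hf : PolyBounded f) (hg : PolyBounded g) :
    PolyBounded fun n => f n * g n := by
  obtain ⟨k, hk⟩ := hf
  obtain ⟨l, hl⟩ := hg
  exact ⟨k + l, fun n => by rw [pow_add]; exact Nat.mul_le_mul (hk n) (hl n)⟩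

theorem PolyBounded.pow {f : ℕ → ℕ} (hf : PolyBounded f) (c : ℕ) :
    PolyBounded fun n => f n ^ c := by
  obtain ⟨k, hk⟩ := hf
  exact ⟨k * c, fun n => by rw [pow_mul]; exact Nat.pow_le_pow_left (hk n) c⟩

theorem PolyBounded.exists_le {f : ℕ → ℕ} (hf : PolyBounded f) : ∃ c, ∀ n, f n ≤ n ^ c + c := by
  obtain ⟨k, hk⟩ := hf
  -- For `n ≥ 2` use `n + 2 ≤ n ^ 2`; for `n < 2` the bound `3 ^ k` is absorbed by the additive
  -- constant.
  refine ⟨2 * k + 3 ^ k, fun n => (hk n).trans ?_⟩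
  rcases lt_or_ge n 2 with hn | hn
  · have : (n + 2) ^ k ≤ 3 ^ k := Nat.pow_le_pow_left (by omega) k
    exact this.trans ((Nat.le_add_left _ _).trans (Nat.le_add_left _ _))
  · have h1 : (n + 2) ^ k ≤ (n ^ 2) ^ k := Nat.pow_le_pow_left (by nlinarith) k
    have h2 : n ^ (2 * k) ≤ n ^ (2 * k + 3 ^ k) := 
      Nat.pow_le_pow_right (by omega) (Nat.le_add_right _ _)
    rw [← pow_mul] at h1
    exact h1.trans (h2.trans (Nat.le_add_right _ _))

/-- A bound for the number of wires that simulate `N` wires. -/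
def simBound (p N : ℕ) : ℕ :=
  (N + N * (2 * (p * (N + 1)) + 1)) + 2 * (N + N * (2 * (p * (N + 1)) + 1)) ^ 2

theorem simBound_mono (p : ℕ) {M N : ℕ} (h : M ≤ N) : simBound p M ≤ simBound p N := by
  unfold simBound
  gcongr

theorem PolyBounded.simBound {f : ℕ → ℕ} (p : ℕ) (hf : PolyBounded f) :
    PolyBounded fun n => simBound p (f n) := by
  have h := hf.add (hf.mul (((const 2).mul ((const p).mul (hf.add (const 1)))).add (const 1)))
  exact h.add ((const 2).mul (h.pow 2))

end PolynomialBounds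

/-! ### Equality of the classes, and the two gate families -/

section Simulation

/-- Numbers the wires other than the inputs, so that they become the ancillas of a circuit in
standard form. -/
theorem exists_equiv_sum {n : ℕ} {X : Type} [Fintype X] [DecidableEq X] (κ : Fin n ↪ X) :
    ∃ (a : ℕ) (e : X ≃ Fin n ⊕ Fin a), κ.trans e.toEmbedding = Function.Embedding.inl := by
  classical
  let e : X ≃ Fin n ⊕ Fin (Fintype.card ((Set.range κ)ᶜ : Set X)) :=
    (Equiv.Set.sumCompl (Set.range κ)).symm.trans
      (Equiv.sumCongr (Equiv.ofInjective κ κ.injective).symm (Fintype.equivFin _))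
  refine ⟨_, e, ?_⟩
  ext1 i
  have h : (Equiv.Set.sumCompl (Set.range κ)).symm (κ i) = Sum.inl ⟨κ i, i, rfl⟩ :=
    Equiv.Set.sumCompl_symm_apply_of_mem (Set.mem_range_self i)
  simp only [e, Function.Embedding.trans_apply, Equiv.coe_toEmbedding, Equiv.trans_apply, h,
    Equiv.sumCongr_apply, Sum.map_inl, Function.Embedding.inl_apply]
  congr 1
  exact Equiv.ofInjective_symm_apply κ.injective i

variable {p : ℕ} [Fact p.Prime]

theorem Implementable.extend {V X Y : Type} [Fintype V] [DecidableEq V] [Fintype X] [DecidableEq X]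
    [Fintype Y] [DecidableEq Y] {ι : V ↪ X} {D : ℕ} {M : Operator p V} (hM : Implementable ι D M)
    (f : X ↪ Y) : Implementable (ι.trans f) D M := by
  obtain ⟨Ls, h1, h2, h3, h4⟩ := hM
  refine ⟨Ls.map (List.map (Gate.map f)), by simpa using h1, ?_, ?_, fun ψ => ?_⟩
  · intro L' hL'
    obtain ⟨L, hL, rfl⟩ := List.mem_map.1 hL'
    exact pairwise_map_gate f (h2 L hL)
  · intro L' hL' g hg
    obtain ⟨L, hL, rfl⟩ := List.mem_map.1 hL'
    obtain ⟨g', hg', rfl⟩ := List.mem_map.1 hg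
    exact Gate.map_mem f (h3 L hL g' hg')
  · rw [← List.map_flatten, ← extendZero_trans, ops_map_mulVec, h4, extendZero_trans]

theorem isUnitary_of_mem {X : Type} {g : Gate p X} (hg : g ∈ (iQNCGates p).withMod X) :
    g.IsUnitary := by
  rcases hg with hg | ⟨S, t, ht, rfl⟩
  · cases g with
    | ctrl => trivial
    | qmod => trivial
    | cfanout => exact hg.elim
  · trivial

/-- With `m = Nat.log p N + 1`, the `p ^ m` linear forms per wire number at most `p * (N + 1)`; the
copies for pairs square the count. -/
theorem card_simWire_le (W : Type) [Fintype W] :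
    Fintype.card (SimWire p W (Nat.log p (Fintype.card W) + 1)) ≤ simBound p (Fintype.card W) := by
  set N := Fintype.card W with hN
  have hp : 1 < p := (Fact.out : p.Prime).one_lt
  have h1 : p ^ (Nat.log p N + 1) ≤ p * (N + 1) := by
    rw [pow_succ, mul_comm]
    refine Nat.mul_le_mul_left p ?_
    rcases Nat.eq_zero_or_pos N with h | h
    · simp [h]
    · exact (Nat.pow_log_le_self p h.ne').trans (Nat.le_succ N)
  have h2 : Nat.log p N + 1 ≤ p ^ (Nat.log p N + 1) := (Nat.lt_pow_self hp).le
  have h3 : Fintype.card (AuxWire p W (Nat.log p N + 1)) ≤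
      N + N * (2 * (p * (N + 1)) + 1) := by
    simp only [Fintype.card_sum, Fintype.card_prod, Fintype.card_fun, ZMod.card, Fintype.card_fin,
      Fintype.card_unit, ← hN]
    exact Nat.add_le_add_left (Nat.mul_le_mul_left N (by omega)) N
  rw [Fintype.card_sum, simBound, Fintype.card_prod, Fintype.card_prod, Fintype.card_bool]
  refine Nat.add_le_add h3 ?_
  calc _ = 2 * Fintype.card (AuxWire p W (Nat.log p N + 1)) ^ 2 := by ring
    _ ≤ _ := by gcongr

theorem exists_simulation {n : ℕ} {W : Type} [Fintype W] [DecidableEq W] (κ : Fin n ↪ W)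
    (Ls : List (List (Gate p W)))
    (hL : ∀ L ∈ Ls, L.Pairwise fun g h => Disjoint g.support h.support) :
    ∃ (a : ℕ) (f : W ↪ Fin n ⊕ Fin a), κ.trans f = Function.Embedding.inl ∧
      n + a ≤ simBound p (Fintype.card W) ∧
      Implementable f (Ls.length * (6 * p + 49)) (ops Ls.flatten) := by
  have hm : Fintype.card W < p ^ (Nat.log p (Fintype.card W) + 1) :=
    Nat.lt_pow_succ_log_self (Fact.out : p.Prime).one_lt _
  have h := implementable_layers hm Ls hL
  obtain ⟨a, e, he⟩ := exists_equiv_sum (κ.trans (simEmb p W (Nat.log p (Fintype.card W) + 1)))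
  refine ⟨a, (simEmb p W _).trans e.toEmbedding, by rw [← he]; rfl, ?_, h.extend e.toEmbedding⟩
  have hc : Fintype.card (SimWire p W (Nat.log p (Fintype.card W) + 1)) = n + a := by
    rw [Fintype.card_congr e, Fintype.card_sum, Fintype.card_fin, Fintype.card_fin]
  exact hc ▸ card_simWire_le W

theorem Implementable.exists_circuit {V X : Type} [Fintype V] [DecidableEq V] [Fintype X]
    [DecidableEq X] {f : V ↪ X} {D : ℕ} {M : Operator p V} (hM : Implementable f D M) :
    ∃ C : Circuit p X, C.depth ≤ D ∧ C.size ≤ D * Fintype.card X ∧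
      (∀ g ∈ C.gates, g ∈ (iQNCGates p).withMod X) ∧
      ∀ ψ, (ops C.gates).mulVec (extendZero f ψ) = extendZero f (M.mulVec ψ) := by
  obtain ⟨Ls, h1, h2, h3, h4⟩ := hM
  refine ⟨⟨Ls, h2⟩, h1, (Circuit.size_le _).trans (Nat.mul_le_mul_right _ h1), fun g hg => ?_, h4⟩
  obtain ⟨L, hL, hg⟩ := List.mem_flatten.1 hg
  exact h3 L hL g hg

theorem iQNC_subset_iQAC {X : Type} : (iQNCGates p).withMod X ⊆ (iQACGates p).withMod X := by
  rintro g (hg | hg)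
  · left
    cases g <;> trivial
  · exact Or.inr hg

theorem constDepthUnitary_eq :
    ConstDepthUnitary (iQNCGates p).withMod = ConstDepthUnitary (iQACGates p).withMod := by
  refine Set.Subset.antisymm ?_ ?_
  · rintro F ⟨D, c, h⟩
    refine ⟨D, c, fun n => ?_⟩
    obtain ⟨a, C, h1, h2, h3, h4, h5⟩ := h n
    exact ⟨a, C, h1, h2, h3, fun g hg => ⟨iQNC_subset_iQAC (h4 g hg).1, (h4 g hg).2⟩, h5⟩
  · rintro F ⟨D, c, h⟩
    have hN : PolyBounded fun n => n + (n ^ c + c) :=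
      PolyBounded.id.add ((PolyBounded.id.pow c).add (.const c))
    -- The added `1` keeps the factor positive, so the same product also bounds the number of
    -- ancillas when `D = 0`.
    obtain ⟨c', hc'⟩ := ((PolyBounded.const (D * (6 * p + 49) + 1)).mul (hN.simBound p)).exists_le
    refine ⟨D * (6 * p + 49), c', fun n => ?_⟩
    obtain ⟨a, C, h1, h2, h3, h4, h5⟩ := h n
    obtain ⟨a', f, hf, ha', hi⟩ := exists_simulation (Function.Embedding.inl : Fin n ↪ Fin n ⊕ Fin a)
      C.layers C.disjoint
    obtain ⟨C', i1, i2, i3, i4⟩ := hi.exists_circuit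
    have hcard : n + a' ≤ simBound p (n + (n ^ c + c)) := by
      refine ha'.trans (simBound_mono p ?_)
      rw [Fintype.card_sum, Fintype.card_fin, Fintype.card_fin]
      omega
    have hD : C.layers.length * (6 * p + 49) ≤ D * (6 * p + 49) := Nat.mul_le_mul_right _ h1
    have hb := hc' n
    refine ⟨a', C', i1.trans hD, ?_, ?_, fun g hg => ⟨i3 g hg, isUnitary_of_mem (i3 g hg)⟩,
      fun ψ => ?_⟩
    · rw [Fintype.card_sum, Fintype.card_fin, Fintype.card_fin] at i2
      refine i2.trans ((Nat.mul_le_mul (hD.trans (Nat.le_succ _)) hcard).trans hb)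
    · refine le_trans ?_ hb
      exact ((Nat.le_add_left a' n).trans hcard).trans
        (Nat.le_mul_of_pos_left _ (Nat.succ_pos _))
    · have h6 := h5 ψ
      rw [Circuit.apply_eq, withAncillas_eq, withAncillas_eq] at h6
      rw [Circuit.apply_eq, withAncillas_eq, withAncillas_eq, ← hf, ← extendZero_trans, i4]
      change extendZero f ((ops C.gates).mulVec _) = _
      rw [h6, extendZero_trans]

theorem constDepth_eq : ConstDepth (iQNCGates p).withMod = ConstDepth (iQACGates p).withMod := by
  refine Set.Subset.antisymm ?_ ?_
  · rintro F ⟨D, c, h⟩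
    refine ⟨D, c, fun n => ?_⟩
    obtain ⟨a, C, out, h1, h2, h3, h4, h5⟩ := h n
    exact ⟨a, C, out, h1, h2, h3, fun g hg => iQNC_subset_iQAC (h4 g hg), h5⟩
  · rintro F ⟨D, c, h⟩
    -- Inputs, ancillas, and one label wire for each gate.
    have hN : PolyBounded fun n => n + (n ^ c + c) + (n ^ c + c) :=
      (PolyBounded.id.add ((PolyBounded.id.pow c).add (.const c))).add
        ((PolyBounded.id.pow c).add (.const c))
    obtain ⟨c', hc'⟩ := ((PolyBounded.const (D * (6 * p + 49) + 1)).mul (hN.simBound p)).exists_le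
    refine ⟨D * (6 * p + 49), c', fun n => ?_⟩
    obtain ⟨a, C, out, h1, h2, h3, h4, h5⟩ := h n
    obtain ⟨R, _, _, Ls, hR, hLs, hnd⟩ := exists_labels C.layers
    let Lc : List (List (Gate p ((Fin n ⊕ Fin a) ⊕ R))) :=
      Ls.map (List.map fun b => b.1.coherent b.2)
    have hLc : ∀ L ∈ Lc, L.Pairwise fun g h => Disjoint g.support h.support := by
      intro L' hL'
      obtain ⟨L, hL, rfl⟩ := List.mem_map.1 hL'
      have d1 : (L.map Prod.fst).Pairwise fun g h => Disjoint g.support h.support :=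
        C.disjoint _ (by rw [← hLs]; exact List.mem_map_of_mem hL)
      have d2 : (L.map Prod.snd).Pairwise (· ≠ ·) := by
        rw [List.map_flatten] at hnd
        exact (List.nodup_flatten.1 hnd).1 _ (List.mem_map_of_mem hL)
      rw [List.pairwise_map] at d1 d2 ⊢
      refine (d1.and d2).imp fun {g h} hgh => ?_
      refine Finset.disjoint_of_subset_left (Gate.coherent_support _ _)
        (Finset.disjoint_of_subset_right (Gate.coherent_support _ _) ?_)
      rw [Finset.disjoint_insert_left, Finset.disjoint_insert_right, Finset.disjoint_map]
      exact ⟨by simpa using hgh.2, by simp, hgh.1⟩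
    have hflat : Lc.flatten = Ls.flatten.map fun b => b.1.coherent b.2 := List.map_flatten.symm
    have hgates : Ls.flatten.map Prod.fst = C.gates := by
      rw [List.map_flatten, hLs]; rfl
    obtain ⟨a', f, hf, ha', hi⟩ := exists_simulation
      ((Function.Embedding.inl : Fin n ↪ Fin n ⊕ Fin a).trans
        (Function.Embedding.inl : (Fin n ⊕ Fin a) ↪ (Fin n ⊕ Fin a) ⊕ R)) Lc hLc
    obtain ⟨C', i1, i2, i3, i4⟩ := hi.exists_circuit
    have hcard : n + a' ≤ simBound p (n + (n ^ c + c) + (n ^ c + c)) := by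
      refine ha'.trans (simBound_mono p ?_)
      rw [Fintype.card_sum, Fintype.card_sum, Fintype.card_fin, Fintype.card_fin, hR]
      exact Nat.add_le_add (Nat.add_le_add_left h3 n) h2
    have hD : Lc.length * (6 * p + 49) ≤ D * (6 * p + 49) := by
      refine Nat.mul_le_mul_right _ (le_trans (le_of_eq ?_) h1)
      rw [Circuit.depth, ← hLs, List.length_map, List.length_map]
    have hb := hc' n
    refine ⟨a', C', (out.trans Function.Embedding.inl).trans f, i1.trans hD, ?_, ?_, i3,
      fun ρ => ?_⟩
    · rw [Fintype.card_sum, Fintype.card_fin, Fintype.card_fin] at i2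
      refine i2.trans ((Nat.mul_le_mul (hD.trans (Nat.le_succ _)) hcard).trans hb)
    · refine le_trans ?_ hb
      exact ((Nat.le_add_left a' n).trans hcard).trans
        (Nat.le_mul_of_pos_left _ (Nat.succ_pos _))
    -- Discarding is split into three traces: first the clean ancillas of the simulation, then the
    -- labels, which turns coherent gates into measurements, and finally the wires that the original
    -- circuit discards.
    · rw [← h5 ρ, C'.channel_eq fun g hg => isUnitary_of_mem (i3 g hg), withAncillasDensity_eq,
        ← hf, ← extendDensity_trans, conj_extendDensity i4, readOut_eq, readOut_eq,
        ← partialTrace_trans, partialTrace_extendDensity, ← partialTrace_trans, hflat,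
        deferred_measurement _ hnd, hgates, ← extendDensity_trans, partialTrace_extendDensity,
        withAncillasDensity_eq]
      · rfl
      · intro q _ Y X hne
        rw [← extendDensity_trans, extendDensity_apply] at hne
        by_contra h0
        refine hne (if_neg fun h => h0 ⟨h.1 _ (by simp), h.2 _ (by simp)⟩)

/-- Families of operators that are products of boundedly many layers of gates. -/
theorem mem_constDepthUnitary_iQAC {F : OperatorFamily p} (D : ℕ)
    (h : ∀ n, ∃ Ls : List (List (Gate p (Fin n))), Ls.length ≤ D ∧
      (∀ L ∈ Ls, L.Pairwise fun g h => Disjoint g.support h.support) ∧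
      (∀ L ∈ Ls, ∀ g ∈ L, g.IsUnitary) ∧ F n = ops Ls.flatten) :
    F ∈ ConstDepthUnitary (iQACGates p).withMod := by
  obtain ⟨c, hc⟩ := ((PolyBounded.const D).mul .id).exists_le
  refine ⟨D, c, fun n => ?_⟩
  obtain ⟨Ls, h1, h2, h3, h4⟩ := h n
  have h1' : (Ls.map (List.map (Gate.map (Function.Embedding.inl : Fin n ↪ Fin n ⊕ Fin 0)))).length
      ≤ D := by simpa using h1
  refine ⟨0, ⟨Ls.map (List.map (Gate.map Function.Embedding.inl)), ?_⟩, h1', ?_, Nat.zero_le _, ?_,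
    fun ψ => ?_⟩
  · intro L' hL'
    obtain ⟨L, hL, rfl⟩ := List.mem_map.1 hL'
    exact pairwise_map_gate _ (h2 L hL)
  · refine (Circuit.size_le _).trans (le_trans ?_ (hc n))
    rw [Fintype.card_sum, Fintype.card_fin, Fintype.card_fin, add_zero]
    exact Nat.mul_le_mul_right n h1'
  · intro g hg
    obtain ⟨L', hL', hg⟩ := List.mem_flatten.1 hg
    obtain ⟨L, hL, rfl⟩ := List.mem_map.1 hL'
    obtain ⟨g', hg', rfl⟩ := List.mem_map.1 hg
    have hu := h3 L hL g' hg'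
    cases g' with
    | ctrl S v t ht U => exact ⟨Or.inl trivial, trivial⟩
    | qmod S t ht => exact ⟨Or.inr ⟨_, _, _, rfl⟩, trivial⟩
    | cfanout c T hc => exact hu.elim
  · rw [Circuit.apply_eq, withAncillas_eq, withAncillas_eq, h4, Circuit.gates,
      ← List.map_flatten, ops_map_mulVec]

theorem toffoli_mem (v : ∀ n, Fin n → ZMod p) (U : ℕ → Matrix.unitaryGroup (ZMod p) ℂ) :
    toffoli v U ∈ ConstDepthUnitary (iQACGates p).withMod := by
  refine mem_constDepthUnitary_iQAC 1 fun n => ?_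
  cases n with
  | zero => exact ⟨[], by simp, by simp, by simp, rfl⟩
  | succ n =>
    refine ⟨[[.ctrl (Finset.univ.erase 0) (v (n + 1)) 0 (Finset.notMem_erase 0 _) (U (n + 1))]],
      by simp, by simp, ?_, ?_⟩
    · intro L hL g hg
      rw [List.mem_singleton.1 hL, List.mem_singleton] at hg
      subst hg
      trivial
    · simp [toffoli]

/-- The one-qudit gate that adds `c`. -/
noncomputable def shiftGate (c : ZMod p) : Matrix.unitaryGroup (ZMod p) ℂ :=
  ⟨Matrix.of fun y x => if y = x + c then 1 else 0, by
    rw [Matrix.mem_unitaryGroup_iff]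
    ext y x
    rw [Matrix.mul_apply, Finset.sum_eq_single (y - c), Matrix.star_apply, Matrix.one_apply]
    · simp [eq_comm (a := x)]
    · intro z _ hz
      have : y ≠ z + c := fun h => hz (by rw [h, add_sub_cancel_right])
      simp [this]
    · simp⟩

theorem sum_shiftGate_mul (c y : ZMod p) (φ : ZMod p → ℂ) :
    ∑ u, (shiftGate c : Matrix (ZMod p) (ZMod p) ℂ) y u * φ u = φ (y - c) := by
  rw [Finset.sum_eq_single (y - c)]
  · simp [shiftGate]
  · intro z _ hz
    have : y ≠ z + c := fun h => hz (by rw [h, add_sub_cancel_right])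
    simp [shiftGate, this]
  · simp

/-- `OR` is `1` minus the indicator of the zero string: shift the target by `1`, then shift back
under control of all zeros. -/
theorem qOR_mem : qOR p ∈ ConstDepthUnitary (iQACGates p).withMod := by
  refine mem_constDepthUnitary_iQAC 2 fun n => ?_
  cases n with
  | zero => exact ⟨[], by simp, by simp, by simp, rfl⟩
  | succ n =>
    refine ⟨[[.ctrl ∅ 0 0 (Finset.notMem_empty 0) (shiftGate 1)],
      [.ctrl (Finset.univ.erase 0) 0 0 (Finset.notMem_erase 0 _) (shiftGate (-1))]],
      by simp, by simp, ?_, ?_⟩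
    · intro L hL g hg
      simp only [List.mem_cons, List.not_mem_nil, or_false] at hL
      rcases hL with rfl | rfl <;> rw [List.mem_singleton] at hg <;> subst hg <;> trivial
    · refine Matrix.ext_of_mulVec_single fun x => ?_
      generalize (Pi.single x 1 : Basis p (Fin (n + 1)) → ℂ) = ψ
      rw [qOR, basisMap_mulVec (g := fun y : Basis p (Fin (n + 1)) =>
        Function.update y 0 (y 0 - if 0 < ∑ i : Fin n, (y i.succ).val then 1 else 0))]
      · ext y
        have hz : (0 < ∑ i : Fin n, (y i.succ).val) ↔
            ¬ ∀ s ∈ Finset.univ.erase (0 : Fin (n + 1)), y s = (0 : Fin (n + 1) → ZMod p) s := by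
          rw [Nat.pos_iff_ne_zero, ne_eq, Finset.sum_eq_zero_iff, not_iff_not]
          simp only [Finset.mem_univ, true_imp_iff, ZMod.val_eq_zero, Finset.mem_erase, and_true,
            Pi.zero_apply]
          rw [Fin.forall_fin_succ]
          simp
        simp only [List.flatten_cons, List.flatten_nil, List.append_nil, List.singleton_append,
          ops_cons, ops_nil, Matrix.one_mul, ← Matrix.mulVec_mulVec, Function.comp]
        rw [ctrl_mulVec]
        simp only [ctrl_mulVec, Finset.notMem_empty, false_imp_iff, implies_true, if_true,
          sum_shiftGate_mul, Function.update_self, Function.update_idem]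
        split_ifs with h1 h2 h2
        · exact (hz.1 h1 h2).elim
        · rfl
        · simp
        · exact (h1 (hz.2 h2)).elim
      · intro y
        simp
      · intro y
        simp

end Simulation

end Qudit

theorem theorem3p4 (p : ℕ) [Fact p.Prime] :
    Qudit.ConstDepth (Qudit.iQNCGates p).withMod =
        Qudit.ConstDepth (Qudit.iQACGates p).withMod ∧
      Qudit.ConstDepthUnitary (Qudit.iQNCGates p).withMod =
        Qudit.ConstDepthUnitary (Qudit.iQACGates p).withMod ∧
      Qudit.qOR p ∈ Qudit.ConstDepthUnitary (Qudit.iQNCGates p).withMod ∧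
      ∀ (v : ∀ n, Fin n → ZMod p) (U : ℕ → Matrix.unitaryGroup (ZMod p) ℂ),
        Qudit.toffoli v U ∈ Qudit.ConstDepthUnitary (Qudit.iQNCGates p).withMod :=
  ⟨Qudit.constDepth_eq, Qudit.constDepthUnitary_eq,
    by rw [Qudit.constDepthUnitary_eq]; exact Qudit.qOR_mem,
    fun v U => by rw [Qudit.constDepthUnitary_eq]; exact Qudit.toffoli_mem v U⟩
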